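/- **Setting.** Let $b\in\mathbb R^3$, $b\neq 0$, $\hat b=b/|b|$, and let $f:\mathbb R\to\mathbb R$ be continuous with $r f(r)\ge 0$ for all $r$. For $\tau,\xi\in\mathbb R^3$ with $|\tau|=1$ put $$\tilde\alpha(\tau,\xi)=\frac{b}{|b\times\tau|}\,f\Big(\frac{b}{|b\times\tau|}\cdot\xi\Big)\ \text{ if } b\times\tau\ne0,\qquad \tilde\alpha(\tau,\xi)=0\ \text{ if } b\times\tau=0 .$$ Let $\mathcal S^3$ be the space of symmetric real $3\times3$ matrices, $\Omega\subseteq\mathbb R^3$ an open set and $0<T_e<\infty$. *Dislocation measures.* A dislocation measure on $\Omega$ is a vector measure $\rho=\tau|\rho|$, where $|\rho|$ is a nonnegative Radon measure on $\Omega$, $\tau$ is a continuous field of unit vectors on $\operatorname{supp}|\rho|$, and $\rho=\operatorname{rot}h$ in the sense of distributions for some $h\in L^1_{\rm loc}(\Omega,\mathbb R^3)$. A moving curve $\ell(t)\subset\Omega$, $t\in[0,T_e)$, is a family of simple curves with a regular parametrization $s\mapsto y(t,s)$ that is jointly $C^1$ on $[0,T_e)\times\mathbb R$; each $\ell(t)$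 is either closed ($y$ has a fixed positive period in $s$), or is parametrized injectively by $\mathbb R$ and has no end points inside $\Omega$ (for every compact $K\subset[0,T_e)\times\Omega$ the set $\{(t,s):(t,y(t,s))\in K\}$ is bounded). Its unit tangent is $\tau(x,t)$, and its measure to the Burgers vector $b$ is $\langle\rho_{\ell(t)},\varphi\rangle=|b|\int_{\ell(t)}\tau\cdot\varphi\,ds$. Write $\operatorname{proj}_\tau$ for the orthogonal projection onto $\{\xi:\xi\cdot\tau=0\}$. The normal velocity $v(x_0,t_0)$ at $x_0\in\ell(t_0)$ is $\frac{d}{dt}x(t)|_{t=t_0}$ (one-sided if $t_0=0$), where $x(t)$, $x(t_0)=x_0$, is the intersection point of $\ell(t)$ with the plane through $x_0$ orthogonal to $\tau(x_0,t_0)$. *Evolution equation.* For $T:[0,T_e)\times\Omega\to\mathcal S^3$, a family of dislocation measures $\rho(t)=\tau|\rho|$ solves $$\partial_t\rho=\operatorname{rot}_x\Big(f\Big(\frac{b\times\tau}{|b\times\tau|}\cdot Tb\Big)\frac{b\times\tau}{|b\times\tau|}\,|\rho|\Big)\tag{3.27}$$ if for all $\varphi\in C_0^\infty((0,T_e)\times\Omega,\mathbb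 R^3)$ the following integrals exist and satisfy $$-\int_0^{T_e}\!\langle\rho(t),\partial_t\varphi(t)\rangle\,dt=\int_0^{T_e}\!\Big\langle f\Big(\frac{b\times\tau}{|b\times\tau|}\cdot Tb\Big)\frac{b\times\tau}{|b\times\tau|}\,|\rho|,\ \operatorname{rot}_x\varphi(t)\Big\rangle dt .$$ **Theorem.** (i) $\xi\cdot\tilde\alpha(\tau,\xi)\ge0$ for all $\tau,\xi\in\mathbb R^3$ with $|\tau|=1$. (ii) Let $T\in C([0,T_e]\times\overline\Omega,\mathcal S^3)$, and let $\ell(t)$ be a moving curve such that $\rho_{\ell(t)}$ is a dislocation measure on $\Omega$ for all $t\in[0,T_e)$ and such that for almost every $t$ one has $b\times\tau(x,t)\neq0$ at $|\rho_{\ell(t)}|$-almost every $x$. Let $F=\tau\times Tb$ and $b^{\perp\tau}=\operatorname{proj}_\tau b/|\operatorname{proj}_\tau b|$. Then $\rho_{\ell(t)}$ solves (3.27) if and only if $$v(x,t)=f\big(b^{\perp\tau}(x,t)\cdot F(x,t)\big)\,b^{\perp\tau}(x,t)$$ for all $t\in[0,T_e)$ and all $x\in\ell(t)$ with $b\times\tau(x,t)\ne0$.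 (iii) Let $D:\mathcal S^3\to\mathcal S^3$ be linear, symmetric and positive definite, and let $(u,T,h_p)$ be a classical solution on $\Omega\times[0,T_e)$ (spatial derivatives exist, time derivative one-sided at $t=0$) of $$-\operatorname{div}_xT=0,\tag{3.29}$$ $$T=D\big(\varepsilon(\nabla_xu)-\varepsilon(\hat b\otimes h_p)\big),\tag{3.30}$$ $$\partial_th_p=f\Big(\frac{b\times\tau}{|b\times\tau|}\cdot Tb\Big)\frac{b\times\tau}{|b\times\tau|}\,|\operatorname{rot}_xh_p|,\tag{3.31}$$ where $\operatorname{rot}_xh_p=\tau|\operatorname{rot}_xh_p|$, $\varepsilon(A)=\frac12(A+A^T)$, and the right-hand side of (3.31) is read as $0$ at points with $b\times\tau=0$ or $\operatorname{rot}_xh_p=0$. If $b\cdot h_p(x,0)=0$ for all $x\in\Omega$, then $\operatorname{trace}(\hat b\otimes h_p(x,t))=0$ for all $(x,t)\in\Omega\times[0,T_e)$, i.e. plastic volume is conserved. -/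

import Mathlib

open MeasureTheory Set Filter
open scoped Topology ContDiff

noncomputable section

namespace Dislocation

/-! ### Vectors, matrices and differential operators in three-dimensional space -/

/-- Three-dimensional Euclidean space. -/
abbrev E : Type := EuclideanSpace ℝ (Fin 3)

/-- Standard basis vector. -/
def e (i : Fin 3) : E := EuclideanSpace.single i (1 : ℝ)

/-- Cross product `a × b`. -/
def cross (a b : E) : E := WithLp.toLp 2 (crossProduct a.ofLp b.ofLp)

/-- The partial derivative `∂_j v_i` at `x`. -/
def pd (v : E → E) (i j : Fin 3) (x : E) : ℝ := fderiv ℝ v x (e j) i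

/-- The rotation (curl) of a vector field. -/
def rot (v : E → E) (x : E) : E :=
  !₂[pd v 2 1 x - pd v 1 2 x, pd v 0 2 x - pd v 2 0 x, pd v 1 0 x - pd v 0 1 x]

/-- The matrix `(∂_j u_i)_{ij}`. -/
def grad (u : E → E) (x : E) : Matrix (Fin 3) (Fin 3) ℝ := Matrix.of fun i j => pd u i j x

/-- The tensor product `a ⊗ b = (a_i b_j)_{ij}`. -/
def tensor (a b : E) : Matrix (Fin 3) (Fin 3) ℝ := Matrix.vecMulVec a.ofLp b.ofLp

/-- The space of symmetric `3 × 3` matrices. -/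
def Sym3 : Submodule ℝ (Matrix (Fin 3) (Fin 3) ℝ) where
  carrier := {A | A.transpose = A}
  add_mem' := by
    intro A B hA hB
    simp only [mem_ofPred_eq] at hA hB ⊢
    rw [Matrix.transpose_add, hA, hB]
  zero_mem' := Matrix.transpose_zero
  smul_mem' := by
    intro c A hA
    simp only [mem_ofPred_eq] at hA ⊢
    rw [Matrix.transpose_smul, hA]

/-- The symmetric part `ε(A) = (A + Aᵀ) / 2`. -/
def eps (A : Matrix (Fin 3) (Fin 3) ℝ) : Sym3 :=
  ⟨(1 / 2 : ℝ) • (A + A.transpose), by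
    change ((1 / 2 : ℝ) • (A + A.transpose)).transpose = (1 / 2 : ℝ) • (A + A.transpose)
    rw [Matrix.transpose_smul, Matrix.transpose_add, Matrix.transpose_transpose, add_comm]⟩

/-- The scalar product `A : B = ∑ a_ij b_ij`. -/
def ddot (A B : Matrix (Fin 3) (Fin 3) ℝ) : ℝ := ∑ i, ∑ j, A i j * B i j

/-- An elasticity tensor: a linear, symmetric, positive definite map on symmetric matrices. -/
structure IsElasticityTensor (D : Sym3 →ₗ[ℝ] Sym3) : Prop where
  symm : ∀ A B : Sym3, ddot (D A).1 B.1 = ddot A.1 (D B).1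
  pos : ∀ A : Sym3, A ≠ 0 → 0 < ddot (D A).1 A.1

/-- The matrix-vector product `S b`. -/
def app (S : Sym3) (b : E) : E := WithLp.toLp 2 (S.1.mulVec b.ofLp)

/-- The divergence of a matrix field, `(div S)_i = ∑_j ∂_j S_ij`. -/
def divergence (S : E → Sym3) (x : E) : E :=
  WithLp.toLp 2 fun i => ∑ j, fderiv ℝ (fun z => (S z).1 i j) x (e j)

/-- Orthogonal projection onto `H = {ξ | ξ · τ = 0}`. -/
def projPerp (τ ξ : E) : E := (Submodule.span ℝ {τ})ᗮ.starProjection ξ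

/-! ### Constitutive functions -/

/-- `α̃(τ, ξ) = (b / |b × τ|) f((b / |b × τ|) · ξ)`; its value is `0` if `b × τ = 0`. -/
def alphaTilde (b : E) (f : ℝ → ℝ) (τ ξ : E) : E :=
  f (inner ℝ (‖cross b τ‖⁻¹ • b) ξ) • (‖cross b τ‖⁻¹ • b)

/-- `f(n · S b) n` with `n = (b × τ) / |b × τ|`; its value is `0` if `b × τ = 0`. -/
def slipFlux (b : E) (f : ℝ → ℝ) (S : Sym3) (τ : E) : E :=
  f (inner ℝ (‖cross b τ‖⁻¹ • cross b τ) (app S b)) • (‖cross b τ‖⁻¹ • cross b τ)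

/-- `slipFlux` is the result of inserting `α̃` into the general expression `α̃(τ, τ × S b) × τ`. -/
theorem cross_alphaTilde (b : E) (f : ℝ → ℝ) (S : Sym3) (τ : E) :
    cross (alphaTilde b f τ (cross τ (app S b))) τ = slipFlux b f S τ := by
  have h1 : ∀ (c : ℝ) (a d : E), cross (c • a) d = c • cross a d := by
    intro c a d
    simp [cross]
  have h2 : inner ℝ b (cross τ (app S b)) = inner ℝ (cross b τ) (app S b) := by
    simp [cross, crossProduct, PiLp.inner_apply, Fin.sum_univ_three]
    ring
  rw [alphaTilde, slipFlux, h1, h1, real_inner_smul_left, real_inner_smul_left, h2]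

/-! ### Dislocation measures -/

/-- A vector-valued measure `dir · mass`, given by a nonnegative measure and a direction field. -/
structure PolarMeasure where
  mass : Measure E
  dir : E → E

/-- `τ μ` is a vector-valued dislocation measure on `Ω`: `μ` is a nonnegative Radon measure on `Ω`,
`τ` is a continuous field of unit vectors on the support of `μ` (relative to `Ω`), and
`τ μ = rot h` in the sense of distributions for some locally integrable `h`. -/
structure IsDislocationMeasure (Ω : Set E) (ρ : PolarMeasure) : Prop where
  mass_compl : ρ.mass Ωᶜ = 0
  radon : ∀ K ⊆ Ω, IsCompact K → ρ.mass K < ⊤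
  dir_cont : ContinuousOn ρ.dir (ρ.mass.support ∩ Ω)
  dir_unit : ∀ x ∈ ρ.mass.support ∩ Ω, ‖ρ.dir x‖ = 1
  exists_rot : ∃ h : E → E, LocallyIntegrableOn h Ω volume ∧
    ∀ φ : E → E, ContDiff ℝ ∞ φ → HasCompactSupport φ → tsupport φ ⊆ Ω →
      ∫ x, inner ℝ (h x) (rot φ x) = ∫ x, inner ℝ (ρ.dir x) (φ x) ∂ρ.mass

/-- Test fields in `C₀^∞((0, Te) × Ω, ℝ³)`. -/
structure IsTestField (Ω : Set E) (Te : ℝ) (φ : ℝ → E → E) : Prop where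
  smooth : ContDiff ℝ ∞ (fun p : ℝ × E => φ p.1 p.2)
  compact : HasCompactSupport (fun p : ℝ × E => φ p.1 p.2)
  supp : tsupport (fun p : ℝ × E => φ p.1 p.2) ⊆ Ioo 0 Te ×ˢ Ω

/-- The time-dependent measure `ρ = τ |ρ|` is a weak solution of
`∂_t ρ = rot (f(n · T b) n |ρ|)`, `n = (b × τ) / |b × τ|`, on `(0, Te) × Ω`: for every test field
all the integrals exist and `-∫ ⟨ρ, ∂_t φ⟩ dt = ∫ ⟨f(n · T b) n |ρ|, rot φ⟩ dt`. -/
def SolvesEvolution (Ω : Set E) (Te : ℝ) (b : E) (f : ℝ → ℝ) (T : ℝ → E → Sym3)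
    (ρ : ℝ → PolarMeasure) : Prop :=
  ∀ φ : ℝ → E → E, IsTestField Ω Te φ →
    (∀ t ∈ Ioo 0 Te,
      Integrable (fun x => inner ℝ ((ρ t).dir x) (deriv (fun s => φ s x) t)) (ρ t).mass ∧
      Integrable (fun x => inner ℝ (slipFlux b f (T t x) ((ρ t).dir x)) (rot (φ t) x))
        (ρ t).mass) ∧
    IntegrableOn
      (fun t => ∫ x, inner ℝ ((ρ t).dir x) (deriv (fun s => φ s x) t) ∂(ρ t).mass) (Ioo 0 Te) ∧
    IntegrableOn
      (fun t => ∫ x, inner ℝ (slipFlux b f (T t x) ((ρ t).dir x)) (rot (φ t) x) ∂(ρ t).mass)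
      (Ioo 0 Te) ∧
    -∫ t in Ioo 0 Te, ∫ x, inner ℝ ((ρ t).dir x) (deriv (fun s => φ s x) t) ∂(ρ t).mass =
      ∫ t in Ioo 0 Te,
        ∫ x, inner ℝ (slipFlux b f (T t x) ((ρ t).dir x)) (rot (φ t) x) ∂(ρ t).mass

/-! ### Moving dislocation curves -/

/-- A simple `C¹` curve moving in `Ω` during `[0, Te)`, given by a regular parametrization
`s ↦ y t s`, jointly `C¹` in `(t, s)`. Closed curves are those with `period > 0`. If `period = 0`
the curve is not closed: by the last field it has no end points inside `Ω` (it runs to the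
boundary or to infinity). -/
structure MovingCurve (Ω : Set E) (Te : ℝ) where
  period : ℝ
  period_nonneg : 0 ≤ period
  y : ℝ → ℝ → E
  contDiffOn : ContDiffOn ℝ 1 (fun p : ℝ × ℝ => y p.1 p.2) (Ico 0 Te ×ˢ univ)
  mem : ∀ t ∈ Ico 0 Te, ∀ s, y t s ∈ Ω
  regular : ∀ t ∈ Ico 0 Te, ∀ s, deriv (y t) s ≠ 0
  simple : ∀ t ∈ Ico 0 Te, ∀ s s', y t s = y t s' ↔ ∃ n : ℤ, s' = s + n * period
  proper : period = 0 → ∀ K : Set (ℝ × E), IsCompact K → K ⊆ Ico 0 Te ×ˢ Ω →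
    ∃ R : ℝ, ∀ t s, (t, y t s) ∈ K → |s| ≤ R

namespace MovingCurve

variable {Ω : Set E} {Te : ℝ} (c : MovingCurve Ω Te)

/-- The set `ℓ(t)`. -/
def carrier (t : ℝ) : Set E := range (c.y t)

/-- The parameter interval that runs through the curve exactly once. -/
def dom : Set ℝ := {s | 0 < c.period → s ∈ Ico 0 c.period}

/-- The unit tangent vector at `x ∈ ℓ(t)`. -/
def tangent (t : ℝ) (x : E) : E :=
  ‖deriv (c.y t) (Function.invFun (c.y t) x)‖⁻¹ • deriv (c.y t) (Function.invFun (c.y t) x)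

/-- The tangent does not depend on the parameter chosen for the point. -/
theorem tangent_apply {t : ℝ} (ht : t ∈ Ico 0 Te) (s : ℝ) :
    c.tangent t (c.y t s) = ‖deriv (c.y t) s‖⁻¹ • deriv (c.y t) s := by
  have h : c.y t s = c.y t (Function.invFun (c.y t) (c.y t s)) :=
    (Function.invFun_eq ⟨s, rfl⟩).symm
  obtain ⟨n, hn⟩ := (c.simple t ht _ _).1 h
  have hp : (fun r => c.y t (r + n * c.period)) = c.y t := by
    funext r
    exact ((c.simple t ht r _).2 ⟨n, rfl⟩).symm
  have hd : deriv (c.y t) (s + n * c.period) = deriv (c.y t) s := by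
    rw [← deriv_comp_add_const, hp]
  rw [tangent, hn, hd]

/-- Arc length on `ℓ(t)`: integration against it is `g ↦ ∫ g(y(t, s)) |∂_s y(t, s)| ds`. -/
def arcLength (t : ℝ) : Measure E :=
  Measure.map (c.y t)
    ((volume.restrict c.dom).withDensity fun s => ENNReal.ofReal ‖deriv (c.y t) s‖)

/-- The dislocation measure of `ℓ(t)` to the Burgers vector `b`, that is
`⟨ρ, φ⟩ = |b| ∫_{ℓ(t)} τ · φ ds`. -/
def rho (b : E) (t : ℝ) : PolarMeasure where
  mass := ENNReal.ofReal ‖b‖ • c.arcLength t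
  dir := c.tangent t

/-- `v` is the normal velocity at `x₀ ∈ ℓ(t₀)`: the derivative at `t₀` of the intersection point
`x(t)` of `ℓ(t)` with the plane through `x₀` orthogonal to the tangent at `x₀`
(a one-sided derivative if `t₀ = 0`). -/
def HasNormalVelocity (t₀ : ℝ) (x₀ v : E) : Prop :=
  ∃ x : ℝ → E, x t₀ = x₀ ∧
    (∀ᶠ t in 𝓝[Ico 0 Te] t₀, x t ∈ c.carrier t ∧ inner ℝ (x t - x₀) (c.tangent t₀ x₀) = 0) ∧
    HasDerivWithinAt x v (Ico 0 Te) t₀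

/-- The Peach-Koehler force `F = τ × T b`. -/
def force (T : ℝ → E → Sym3) (b : E) (t : ℝ) (x : E) : E :=
  cross (c.tangent t x) (app (T t x) b)

/-- The unit vector in the direction of the projection of `b` to the orthogonal space of the
tangent. -/
def bPerp (b : E) (t : ℝ) (x : E) : E :=
  ‖projPerp (c.tangent t x) b‖⁻¹ • projPerp (c.tangent t x) b

end MovingCurve

/-! ### The field equations -/

/-- `(u, T, h)` is a classical solution on `Ω × [0, Te)` of
`-div T = 0`, `T = D (ε(∇u) - ε(b̂ ⊗ h))`,
`∂_t h = f(n · T b) n |rot h|`, `n = (b × τ) / |b × τ|`, where `rot h = τ |rot h|`. -/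
structure IsFieldSolution (Ω : Set E) (Te : ℝ) (b : E) (f : ℝ → ℝ) (D : Sym3 →ₗ[ℝ] Sym3)
    (u : ℝ → E → E) (T : ℝ → E → Sym3) (h τ : ℝ → E → E) : Prop where
  diff_u : ∀ t ∈ Ico 0 Te, ∀ x ∈ Ω, DifferentiableAt ℝ (u t) x
  diff_T : ∀ t ∈ Ico 0 Te, ∀ x ∈ Ω, ∀ i j, DifferentiableAt ℝ (fun z => (T t z).1 i j) x
  diff_h : ∀ t ∈ Ico 0 Te, ∀ x ∈ Ω, DifferentiableAt ℝ (h t) x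
  balance : ∀ t ∈ Ico 0 Te, ∀ x ∈ Ω, -divergence (T t) x = 0
  stress : ∀ t ∈ Ico 0 Te, ∀ x ∈ Ω,
    T t x = D (eps (grad (u t) x) - eps (tensor (‖b‖⁻¹ • b) (h t x)))
  polar : ∀ t ∈ Ico 0 Te, ∀ x ∈ Ω, rot (h t) x = ‖rot (h t) x‖ • τ t x
  evolution : ∀ t ∈ Ico 0 Te, ∀ x ∈ Ω,
    HasDerivWithinAt (fun s => h s x) (‖rot (h t) x‖ • slipFlux b f (T t x) (τ t x)) (Ico 0 Te) t

end Dislocation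

end

open Dislocation

noncomputable section

namespace Dislocation

/-! ### Vector algebra -/

/-! Part (i) is the inequality `r f(r) ≥ 0` for `r = b · ξ / |b × τ|`. Part (iii) holds because
`trace (b̂ ⊗ h) = b̂ · h`, while `∂_t h` is a multiple of `b × τ` and hence orthogonal to `b`; so `b
· h` is constant in time at every point.

Part (ii) is proved in the parameters `(t, s)`. For a test field `φ` put `g(t, s) = φ(t, y(t, s))`.
The chain rule gives `g_t · y_s - g_s · y_t = ∂_t φ · y_s + rot φ · (y_t × y_s)`, and the integral
of the left side vanishes (`integral_transport`). For `y` of class `C²` this is integration by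
parts; since `y` is only `C¹`, `integral_inner_partials_eq_zero` works with differences in `s`, on
which the `t`-derivative can act. Thus the weak equation says that `∫∫ rot φ · W = 0` for all `φ`,
where the defect is `W = y_t × y_s - |y_s| f(n · T b) n` with `n = (b × τ) / |b × τ|`
(`solvesEvolution_iff`).

On the other side, the normal velocity is the normal part of `y_t` (`hasNormalVelocity_iff`). The
cross product with `τ` is injective on the normal plane and maps the proposed velocity to the slip
flux, so the law of motion at a point says `W = 0` there (`hasNormalVelocity_law_iff`).

It remains to compare `W = 0` with its weak form. If `W = 0` wherever `b × τ ≠ 0`, then `W = 0`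
almost everywhere and the integrals vanish. Conversely, near a point with `b × τ ≠ 0` the defect is
continuous. Test fields concentrated there at scale `ε` in space and `ε²` in time see, in the limit,
the tangent line carrying the constant vector `W` (`exists_integral_rot_line_eq_zero`). As `W` is
normal to the line, one explicit field forces `W = 0` (`eq_zero_of_integral_rot_line`). The time `t
= 0`, invisible to test fields, follows by continuity. -/

theorem inner_eq_sum (a c : E) : inner ℝ a c = a 0 * c 0 + a 1 * c 1 + a 2 * c 2 := by
  simp [PiLp.inner_apply, Fin.sum_univ_three]; ring

@[simp] theorem cross_apply_zero (a c : E) : cross a c 0 = a 1 * c 2 - a 2 * c 1 := by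
  simp [cross, crossProduct]

@[simp] theorem cross_apply_one (a c : E) : cross a c 1 = a 2 * c 0 - a 0 * c 2 := by
  simp [cross, crossProduct]

@[simp] theorem cross_apply_two (a c : E) : cross a c 2 = a 0 * c 1 - a 1 * c 0 := by
  simp [cross, crossProduct]

theorem ext_three {a c : E} (h0 : a 0 = c 0) (h1 : a 1 = c 1) (h2 : a 2 = c 2) : a = c := by
  ext i; fin_cases i <;> assumption

theorem cross_smul_left (k : ℝ) (a c : E) : cross (k • a) c = k • cross a c := by
  apply ext_three <;> simp <;> ring

theorem cross_smul_right (k : ℝ) (a c : E) : cross a (k • c) = k • cross a c := by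
  apply ext_three <;> simp <;> ring

theorem cross_sub_left (a a' c : E) : cross (a - a') c = cross a c - cross a' c := by
  apply ext_three <;> simp <;> ring

theorem cross_self (a : E) : cross a a = 0 := by
  apply ext_three <;> simp <;> ring

theorem inner_cross_self_left (a c : E) : inner ℝ a (cross a c) = 0 := by
  simp [inner_eq_sum]; ring

theorem inner_cross_self_right (a c : E) : inner ℝ c (cross a c) = 0 := by
  simp [inner_eq_sum]; ring

theorem inner_cross_rotate (a c d : E) : inner ℝ a (cross c d) = inner ℝ (cross a c) d := by
  simp [inner_eq_sum]; ring

theorem cross_cross_self (a c : E) :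
    cross (cross a c) a = (inner ℝ a a : ℝ) • c - (inner ℝ a c : ℝ) • a := by
  rw [inner_eq_sum, inner_eq_sum]
  apply ext_three <;> simp <;> ring

theorem continuous_cross : Continuous fun p : E × E => cross p.1 p.2 := by
  unfold cross
  simp only [crossProduct, LinearMap.mk₂_apply]
  refine (PiLp.continuous_toLp 2 _).comp (continuous_pi fun i => ?_)
  fin_cases i <;> simp <;> fun_prop

/-- A vector orthogonal to a unit vector `τ` is determined by its cross product with `τ`. -/
theorem cross_left_injective {τ a c : E} (hτ : ‖τ‖ = 1) (ha : inner ℝ τ a = 0)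
    (hc : inner ℝ τ c = 0) (h : cross a τ = cross c τ) : a = c := by
  have key : ∀ d : E, inner ℝ τ d = 0 → cross τ (cross d τ) = d := by
    intro d hd
    have h1 : cross τ (cross d τ) = (inner ℝ τ τ : ℝ) • d - (inner ℝ τ d : ℝ) • τ := by
      rw [inner_eq_sum, inner_eq_sum]
      apply ext_three <;> simp <;> ring
    rw [h1, hd, real_inner_self_eq_norm_sq, hτ]; simp
  rw [← key a ha, ← key c hc, h]

/-- Lagrange's identity. It yields `|proj_τ b| = |b × τ|` for unit `τ`, so `b^{⊥τ}` and the slip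
direction are normalised by the same number. -/
theorem norm_cross_sq (a c : E) :
    ‖cross a c‖ ^ 2 = ‖a‖ ^ 2 * ‖c‖ ^ 2 - (inner ℝ a c : ℝ) ^ 2 := by
  simp only [← real_inner_self_eq_norm_sq, inner_eq_sum, cross_apply_zero, cross_apply_one,
    cross_apply_two]
  ring

theorem inner_projPerp (τ ξ : E) : inner ℝ τ (projPerp τ ξ) = 0 :=
  Submodule.mem_orthogonal_singleton_iff_inner_right.1
    ((Submodule.span ℝ {τ})ᗮ.starProjection_apply_mem ξ)

theorem projPerp_eq {τ : E} (hτ : ‖τ‖ = 1) (ξ : E) :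
    projPerp τ ξ = ξ - (inner ℝ τ ξ : ℝ) • τ := by
  rw [projPerp, Submodule.starProjection_orthogonal_val,
    Submodule.starProjection_unit_singleton ℝ hτ]

theorem cross_projPerp {τ : E} (hτ : ‖τ‖ = 1) (ξ : E) : cross (projPerp τ ξ) τ = cross ξ τ := by
  rw [projPerp_eq hτ, cross_sub_left, cross_smul_left, cross_self, smul_zero, sub_zero]

theorem norm_projPerp {τ : E} (hτ : ‖τ‖ = 1) (ξ : E) : ‖projPerp τ ξ‖ = ‖cross ξ τ‖ := by
  have h := norm_cross_sq (projPerp τ ξ) τ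
  rw [cross_projPerp hτ, hτ, real_inner_comm, inner_projPerp] at h
  rw [← sq_eq_sq₀ (norm_nonneg _) (norm_nonneg _), h]; ring

/-! ### The slip direction and the flux -/

/-- The unit vector `(b × τ) / |b × τ|`, with value `0` if `b × τ = 0`. -/
def slipDir (b τ : E) : E := ‖cross b τ‖⁻¹ • cross b τ

/-- `f(n · q) n` with `n = (b × τ) / |b × τ|`. -/
def fluxFn (b : E) (f : ℝ → ℝ) (q τ : E) : E := f (inner ℝ (slipDir b τ) q) • slipDir b τ

theorem slipFlux_eq (b : E) (f : ℝ → ℝ) (S : Sym3) (τ : E) :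
    slipFlux b f S τ = fluxFn b f (app S b) τ := rfl

/-- Homogeneity of degree zero: the unit tangent may be replaced by `∂_s y`. -/
theorem slipDir_smul (b τ : E) {k : ℝ} (hk : 0 < k) : slipDir b (k • τ) = slipDir b τ := by
  rw [slipDir, slipDir, cross_smul_right, norm_smul, smul_smul, Real.norm_of_nonneg hk.le]
  congr 1
  field_simp

theorem fluxFn_smul (b : E) (f : ℝ → ℝ) (q τ : E) {k : ℝ} (hk : 0 < k) :
    fluxFn b f q (k • τ) = fluxFn b f q τ := by
  rw [fluxFn, fluxFn, slipDir_smul b τ hk]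

theorem norm_slipDir_le (b τ : E) : ‖slipDir b τ‖ ≤ 1 := by
  rw [slipDir, norm_smul, norm_inv, norm_norm]
  exact inv_mul_le_one

theorem measurable_fluxFn (b : E) {f : ℝ → ℝ} (hf : Continuous f) :
    Measurable fun p : E × E => fluxFn b f p.1 p.2 := by
  have h1 : Measurable fun p : E × E => cross b p.2 :=
    (continuous_cross.comp (continuous_const.prodMk continuous_snd)).measurable
  have h2 : Measurable fun p : E × E => slipDir b p.2 := h1.norm.inv.smul h1
  exact (hf.measurable.comp (h2.inner measurable_fst)).smul h2

theorem continuousAt_fluxFn (b : E) {f : ℝ → ℝ} (hf : Continuous f) {p : E × E}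
    (hp : cross b p.2 ≠ 0) : ContinuousAt (fun p : E × E => fluxFn b f p.1 p.2) p := by
  have h1 : Continuous fun p : E × E => cross b p.2 :=
    continuous_cross.comp (continuous_const.prodMk continuous_snd)
  have h2 : ContinuousAt (fun p : E × E => slipDir b p.2) p :=
    (h1.continuousAt.norm.inv₀ (norm_ne_zero_iff.2 hp)).smul h1.continuousAt
  exact (hf.continuousAt.comp (h2.inner continuousAt_fst)).smul h2

/-- The slip direction has length at most `1`, so `f` is only evaluated on `[-M, M]`. The bound is
uniform up to the set `b × τ = 0`, where the flux need not be continuous. -/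
theorem exists_norm_fluxFn_le (b : E) {f : ℝ → ℝ} (hf : Continuous f) (M : ℝ) :
    ∃ C, 0 ≤ C ∧ ∀ q τ : E, ‖q‖ ≤ M → ‖fluxFn b f q τ‖ ≤ C := by
  obtain ⟨C, hC⟩ := (isCompact_Icc (a := -M) (b := M)).exists_bound_of_continuousOn
    hf.continuousOn
  refine ⟨max C 0, le_max_right _ _, fun q τ hq => ?_⟩
  have hin : |inner ℝ (slipDir b τ) q| ≤ M :=
    (abs_real_inner_le_norm _ _).trans
      ((mul_le_of_le_one_left (norm_nonneg _) (norm_slipDir_le b τ)).trans hq)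
  rw [fluxFn, norm_smul]
  calc _ ≤ max C 0 * 1 := mul_le_mul ((hC _ (abs_le.1 hin)).trans (le_max_left _ _))
        (norm_slipDir_le b τ) (norm_nonneg _) (le_max_right _ _)
    _ = _ := mul_one _

/-- The slip flux is the cross product with `τ` of the force law for the normal velocity. -/
theorem cross_force_law (b : E) (f : ℝ → ℝ) (q : E) {τ : E} (hτ : ‖τ‖ = 1) :
    cross (f (inner ℝ (‖projPerp τ b‖⁻¹ • projPerp τ b) (cross τ q)) •
      (‖projPerp τ b‖⁻¹ • projPerp τ b)) τ = fluxFn b f q τ := by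
  have h : cross (‖projPerp τ b‖⁻¹ • projPerp τ b) τ = slipDir b τ := by
    rw [cross_smul_left, cross_projPerp hτ, norm_projPerp hτ, slipDir]
  rw [cross_smul_left, h, inner_cross_rotate, h, fluxFn]

theorem inner_alphaTilde_nonneg (b : E) {f : ℝ → ℝ} (hf : ∀ r : ℝ, 0 ≤ r * f r) (τ ξ : E) :
    0 ≤ inner ℝ ξ (alphaTilde b f τ ξ) := by
  rw [alphaTilde, real_inner_smul_right, real_inner_comm, mul_comm]
  exact hf _

/-! ### Rotation of vector fields -/

/-- The rotation as a linear function of the derivative. -/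
def rotL : (E →L[ℝ] E) →L[ℝ] E :=
  LinearMap.toContinuousLinearMap
    { toFun := fun L => !₂[L (e 1) 2 - L (e 2) 1, L (e 2) 0 - L (e 0) 2, L (e 0) 1 - L (e 1) 0]
      map_add' := by intro L M; apply ext_three <;> simp <;> ring
      map_smul' := by intro k L; apply ext_three <;> simp <;> ring }

theorem rot_eq (v : E → E) (x : E) : rot v x = rotL (fderiv ℝ v x) := rfl

/-- The rotation is the axial vector of the skew part of the derivative. With `a = y_t`, `c = y_s`
this produces the term `rot φ · (y_t × y_s)` of the transport identity. -/
theorem inner_rotL_cross (L : E →L[ℝ] E) (a c : E) :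
    inner ℝ (rotL L) (cross a c) = inner ℝ (L a) c - inner ℝ (L c) a := by
  have hL : ∀ d : E, L d = d 0 • L (e 0) + d 1 • L (e 1) + d 2 • L (e 2) := by
    intro d
    have : d = d 0 • e 0 + d 1 • e 1 + d 2 • e 2 := by
      apply ext_three <;> simp [e]
    conv_lhs => rw [this]
    simp only [map_add, map_smul]
  rw [hL a, hL c]
  simp [inner_eq_sum, rotL]
  ring

theorem rotL_smulRight (l : E →L[ℝ] ℝ) (m a : E) (hl : ∀ u, l u = inner ℝ m u) :
    rotL (l.smulRight a) = cross m a := by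
  apply ext_three <;> simp [rotL, hl, inner_eq_sum, e]

/-! ### Conservation of plastic volume -/

/-- The right side of the evolution equation is a multiple of `b × τ`, so `b · h` has zero
derivative (one-sided at `t = 0`), and the mean value inequality with constant `0` makes it
constant. -/
theorem IsFieldSolution.trace_eq_zero {Ω : Set E} {Te : ℝ} {b : E} {f : ℝ → ℝ}
    {D : Sym3 →ₗ[ℝ] Sym3} {u : ℝ → E → E} {T : ℝ → E → Sym3} {h τ : ℝ → E → E}
    (hTe : 0 < Te) (H : IsFieldSolution Ω Te b f D u T h τ)
    (h0 : ∀ x ∈ Ω, inner ℝ b (h 0 x) = 0) {t : ℝ} (ht : t ∈ Ico 0 Te) {x : E} (hx : x ∈ Ω) :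
    Matrix.trace (tensor (‖b‖⁻¹ • b) (h t x)) = 0 := by
  have hd : ∀ s ∈ Ico 0 Te, HasDerivWithinAt (fun s => inner ℝ b (h s x)) 0 (Ico 0 Te) s := by
    intro s hs
    have h1 := (hasDerivWithinAt_const s (Ico 0 Te) b).inner ℝ (H.evolution s hs x hx)
    rwa [inner_zero_left, add_zero, slipFlux, real_inner_smul_right, real_inner_smul_right,
      real_inner_smul_right, inner_cross_self_left, mul_zero, mul_zero, mul_zero] at h1
  have hc : inner ℝ b (h t x) = inner ℝ b (h 0 x) := by
    have hb := (convex_Ico 0 Te).norm_image_sub_le_of_norm_hasDerivWithin_le (C := 0) hd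
      (by simp) (left_mem_Ico.2 hTe) ht
    rw [zero_mul] at hb
    exact sub_eq_zero.1 (norm_le_zero_iff.1 hb)
  rw [h0 x hx, inner_eq_sum] at hc
  have : Matrix.trace (tensor (‖b‖⁻¹ • b) (h t x)) =
      ‖b‖⁻¹ * (b 0 * h t x 0 + b 1 * h t x 1 + b 2 * h t x 2) := by
    simp [tensor, Matrix.trace, Fin.sum_univ_three, Matrix.vecMulVec_apply]
    ring
  rw [this, hc, mul_zero]

/-! ### Integration by parts for maps of class `C¹` of two variables -/

/-- `∫∫ (∂_t G · ∂_s Y - ∂_s G · ∂_t Y) = 0` for `C¹` maps, if `G` vanishes at the ends of the time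
interval and translations in `s` do not change the integral over `[α, β]`. -/
theorem integral_inner_partials_eq_zero {G Y Gt Gs Yt Ys : ℝ → ℝ → E} {a b α β : ℝ} (hab : a ≤ b)
    (cG : Continuous fun p : ℝ × ℝ => G p.1 p.2) (cY : Continuous fun p : ℝ × ℝ => Y p.1 p.2)
    (cGt : Continuous fun p : ℝ × ℝ => Gt p.1 p.2) (cGs : Continuous fun p : ℝ × ℝ => Gs p.1 p.2)
    (cYt : Continuous fun p : ℝ × ℝ => Yt p.1 p.2) (cYs : Continuous fun p : ℝ × ℝ => Ys p.1 p.2)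
    (hGt : ∀ t ∈ Ioo a b, ∀ s, HasDerivAt (fun t => G t s) (Gt t s) t)
    (hYt : ∀ t ∈ Ioo a b, ∀ s, HasDerivAt (fun t => Y t s) (Yt t s) t)
    (hGs : ∀ t ∈ Icc a b, ∀ s, HasDerivAt (G t) (Gs t s) s)
    (hYs : ∀ t ∈ Icc a b, ∀ s, HasDerivAt (Y t) (Ys t s) s)
    (hGa : ∀ s, G a s = 0) (hGb : ∀ s, G b s = 0)
    (hshift : ∀ t ∈ Icc a b, ∀ h : ℝ, |h| ≤ 1 →
      ∫ s in α..β, inner ℝ (G t (s - h)) (Yt t s) = ∫ s in α..β, inner ℝ (G t s) (Yt t (s + h))) :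
    ∫ t in a..b, ∫ s in α..β, (inner ℝ (Gt t s) (Ys t s) - inner ℝ (Gs t s) (Yt t s) : ℝ) = 0 := by
  have fG : ∀ {X : Type} [TopologicalSpace X] {u v : X → ℝ}, Continuous u → Continuous v →
      Continuous fun x => G (u x) (v x) := fun hu hv => cG.comp (hu.prodMk hv)
  have fY : ∀ {X : Type} [TopologicalSpace X] {u v : X → ℝ}, Continuous u → Continuous v →
      Continuous fun x => Y (u x) (v x) := fun hu hv => cY.comp (hu.prodMk hv)
  have fGt : ∀ {X : Type} [TopologicalSpace X] {u v : X → ℝ}, Continuous u → Continuous v →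
      Continuous fun x => Gt (u x) (v x) := fun hu hv => cGt.comp (hu.prodMk hv)
  have fGs : ∀ {X : Type} [TopologicalSpace X] {u v : X → ℝ}, Continuous u → Continuous v →
      Continuous fun x => Gs (u x) (v x) := fun hu hv => cGs.comp (hu.prodMk hv)
  have fYt : ∀ {X : Type} [TopologicalSpace X] {u v : X → ℝ}, Continuous u → Continuous v →
      Continuous fun x => Yt (u x) (v x) := fun hu hv => cYt.comp (hu.prodMk hv)
  have fYs : ∀ {X : Type} [TopologicalSpace X] {u v : X → ℝ}, Continuous u → Continuous v →
      Continuous fun x => Ys (u x) (v x) := fun hu hv => cYs.comp (hu.prodMk hv)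
  -- The integrand with opposite shifts in its two terms. Averaging over `l ∈ [0, 1]` turns `Ys` and
  -- `Gs` into difference quotients of `Y` and `G`, so no mixed second derivative is needed.
  set k : ℝ → ℝ → ℝ → ℝ → ℝ := fun h t s l =>
    inner ℝ (Gt t s) (Ys t (s + l * h)) - inner ℝ (Gs t (s - l * h)) (Yt t s) with hk
  have ck : Continuous fun p : ((ℝ × ℝ) × ℝ) × ℝ => k p.1.1.1 p.1.1.2 p.1.2 p.2 := by
    refine Continuous.sub (Continuous.inner (fGt ?_ ?_) (fYs ?_ ?_))
      (Continuous.inner (fGs ?_ ?_) (fYt ?_ ?_)) <;> fun_prop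
  have ck1 : Continuous fun p : (ℝ × ℝ) × ℝ => ∫ l in (0 : ℝ)..1, k p.1.1 p.1.2 p.2 l :=
    intervalIntegral.continuous_parametric_intervalIntegral_of_continuous'
      (f := fun (p : (ℝ × ℝ) × ℝ) l => k p.1.1 p.1.2 p.2 l) ck 0 1
  have ck2 : Continuous fun p : ℝ × ℝ => ∫ s in α..β, ∫ l in (0 : ℝ)..1, k p.1 p.2 s l :=
    intervalIntegral.continuous_parametric_intervalIntegral_of_continuous'
      (f := fun (p : ℝ × ℝ) s => ∫ l in (0 : ℝ)..1, k p.1 p.2 s l) ck1 α β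
  set K : ℝ → ℝ := fun h => ∫ t in a..b, ∫ s in α..β, ∫ l in (0 : ℝ)..1, k h t s l with hK
  have cK : Continuous K :=
    intervalIntegral.continuous_parametric_intervalIntegral_of_continuous'
      (f := fun (h : ℝ) t => ∫ s in α..β, ∫ l in (0 : ℝ)..1, k h t s l) ck2 a b
  have inner_int : ∀ h, ∀ t ∈ Icc a b, ∀ s, h * ∫ l in (0 : ℝ)..1, k h t s l =
      inner ℝ (Gt t s) (Y t (s + h)) + inner ℝ (G t (s - h)) (Yt t s)
        - (inner ℝ (Gt t s) (Y t s) + inner ℝ (G t s) (Yt t s)) := by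
    intro h t ht s
    have hd : ∀ l ∈ uIcc (0 : ℝ) 1, HasDerivAt
        (fun l => inner ℝ (Gt t s) (Y t (s + l * h)) + inner ℝ (G t (s - l * h)) (Yt t s))
        (h * k h t s l) l := by
      intro l _
      have h1 : HasDerivAt (fun l : ℝ => s + l * h) h l := by
        simpa using ((hasDerivAt_id l).mul_const h).const_add s
      have h2 : HasDerivAt (fun l : ℝ => s - l * h) (-h) l := by
        simpa using ((hasDerivAt_id l).mul_const h).const_sub s
      have h3 := (hYs t ht (s + l * h)).scomp l h1
      have h4 := (hGs t ht (s - l * h)).scomp l h2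
      have h5 := ((hasDerivAt_const l (Gt t s)).inner ℝ h3).add
        (h4.inner ℝ (hasDerivAt_const l (Yt t s)))
      refine h5.congr_deriv ?_
      simp only [inner_zero_left, inner_zero_right, real_inner_smul_left, real_inner_smul_right, hk]
      ring
    rw [← intervalIntegral.integral_const_mul, intervalIntegral.integral_eq_sub_of_hasDerivAt hd]
    · simp only [one_mul, zero_mul, add_zero, sub_zero]
    · refine Continuous.intervalIntegrable ?_ _ _
      exact continuous_const.mul
        (ck.comp (continuous_const.prodMk continuous_id : Continuous fun l => (((h, t), s), l)))
  have K_zero : ∀ h : ℝ, |h| ≤ 1 → h * K h = 0 := by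
    intro h hh
    have cA : Continuous fun p : ℝ × ℝ => (inner ℝ (Gt p.1 p.2) (Y p.1 (p.2 + h)) : ℝ) :=
      (fGt continuous_fst continuous_snd).inner (fY continuous_fst (by fun_prop))
    have cB : Continuous fun p : ℝ × ℝ => (inner ℝ (G p.1 (p.2 - h)) (Yt p.1 p.2) : ℝ) :=
      (fG continuous_fst (by fun_prop)).inner (fYt continuous_fst continuous_snd)
    have cB' : Continuous fun p : ℝ × ℝ => (inner ℝ (G p.1 p.2) (Yt p.1 (p.2 + h)) : ℝ) :=
      (fG continuous_fst continuous_snd).inner (fYt continuous_fst (by fun_prop))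
    have cC : Continuous fun p : ℝ × ℝ => (inner ℝ (Gt p.1 p.2) (Y p.1 p.2) : ℝ) :=
      (fGt continuous_fst continuous_snd).inner (fY continuous_fst continuous_snd)
    have cD : Continuous fun p : ℝ × ℝ => (inner ℝ (G p.1 p.2) (Yt p.1 p.2) : ℝ) :=
      (fG continuous_fst continuous_snd).inner (fYt continuous_fst continuous_snd)
    have slice : ∀ {F : ℝ × ℝ → ℝ}, Continuous F → ∀ t,
        IntervalIntegrable (fun s => F (t, s)) volume α β := fun hF t =>
      (hF.comp (continuous_const.prodMk continuous_id)).intervalIntegrable _ _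
    -- `hshift` moves the shift from `G` to `Yt`; the integrand becomes the time derivative of `G(t,
    -- s) · (Y(t, s + h) - Y(t, s))`.
    have e1 : h * K h = ∫ t in a..b, ∫ s in α..β,
        (((inner ℝ (Gt t s) (Y t (s + h)) + inner ℝ (G t s) (Yt t (s + h)))
          - (inner ℝ (Gt t s) (Y t s) + inner ℝ (G t s) (Yt t s)) : ℝ)) := by
      rw [hK, ← intervalIntegral.integral_const_mul]
      refine intervalIntegral.integral_congr fun t ht => ?_
      rw [uIcc_of_le hab] at ht
      rw [← intervalIntegral.integral_const_mul]
      simp only [inner_int h t ht]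
      rw [intervalIntegral.integral_sub ((slice cA t).add (slice cB t))
          ((slice cC t).add (slice cD t)),
        intervalIntegral.integral_sub ((slice cA t).add (slice cB' t))
          ((slice cC t).add (slice cD t)),
        intervalIntegral.integral_add (slice cA t) (slice cB t),
        intervalIntegral.integral_add (slice cA t) (slice cB' t), hshift t ht h hh]
    -- Integrating in time first leaves boundary terms only, and `G` vanishes at both ends.
    rw [e1, intervalIntegral_intervalIntegral_swap]
    · rw [intervalIntegral.integral_congr (g := fun _ => (0 : ℝ))]
      · simp
      intro s _
      beta_reduce
      rw [intervalIntegral.integral_eq_sub_of_hasDerivAt_of_le hab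
        (f := fun t => (inner ℝ (G t s) (Y t (s + h)) - inner ℝ (G t s) (Y t s) : ℝ))]
      · simp [hGa, hGb]
      · refine Continuous.continuousOn (Continuous.sub (Continuous.inner (fG ?_ ?_) (fY ?_ ?_))
          (Continuous.inner (fG ?_ ?_) (fY ?_ ?_))) <;> fun_prop
      · intro t ht
        refine (((hGt t ht s).inner ℝ (hYt t ht (s + h))).sub
          ((hGt t ht s).inner ℝ (hYt t ht s))).congr_deriv ?_
        ring
      · refine Continuous.intervalIntegrable ?_ _ _
        exact ((cA.add cB').sub (cC.add cD)).comp
          (continuous_id.prodMk continuous_const : Continuous fun t : ℝ => (t, s))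
    · exact ((cA.add cB').sub (cC.add cD)).continuousOn.integrableOn_compact
        (isCompact_uIcc.prod isCompact_uIcc) |>.mono_set
        (prod_mono uIoc_subset_uIcc uIoc_subset_uIcc)
  -- `K` vanishes for small `h ≠ 0` and is continuous; its value at `0` is the integral in question.
  have K0 : K 0 = 0 := by
    refine tendsto_nhds_unique (f := K) (l := 𝓝[≠] (0 : ℝ))
      (cK.tendsto 0 |>.mono_left nhdsWithin_le_nhds) (tendsto_const_nhds.congr' ?_)
    have : ∀ᶠ h : ℝ in 𝓝 0, |h| ≤ 1 := by
      filter_upwards [Metric.closedBall_mem_nhds (0 : ℝ) one_pos] with h hh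
      simpa using hh
    filter_upwards [self_mem_nhdsWithin, this.filter_mono nhdsWithin_le_nhds] with h h0 h1
    exact ((mul_eq_zero.1 (K_zero h h1)).resolve_left h0).symm
  simpa [hK, hk] using K0

namespace MovingCurve

variable {Ω : Set E} {Te : ℝ} (c : MovingCurve Ω Te)

/-! ### Partial derivatives of the parametrization -/

/-- The domain of the parametrization in the `(t, s)`-plane. -/
def strip (Te : ℝ) : Set (ℝ × ℝ) := Ico 0 Te ×ˢ univ

/-- The parametrization as a function of a pair. -/
def Y (p : ℝ × ℝ) : E := c.y p.1 p.2

/-- The time derivative of the parametrization (one-sided at `t = 0`). -/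
def dt (p : ℝ × ℝ) : E := fderivWithin ℝ c.Y (strip Te) p (1, 0)

/-- The derivative of the parametrization with respect to the parameter of the curve. -/
def ds (p : ℝ × ℝ) : E := deriv (c.y p.1) p.2

theorem uniqueDiffOn_strip : UniqueDiffOn ℝ (strip Te) :=
  (uniqueDiffOn_Ico 0 Te).prod uniqueDiffOn_univ

theorem mem_strip {p : ℝ × ℝ} : p ∈ strip Te ↔ p.1 ∈ Ico 0 Te := by simp [strip]

theorem hasFDerivWithinAt {p : ℝ × ℝ} (hp : p.1 ∈ Ico 0 Te) :
    HasFDerivWithinAt c.Y (fderivWithin ℝ c.Y (strip Te) p) (strip Te) p :=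
  (c.contDiffOn.differentiableOn one_ne_zero p (mem_strip.2 hp)).hasFDerivWithinAt

theorem fderivWithin_snd {p : ℝ × ℝ} (hp : p.1 ∈ Ico 0 Te) :
    HasDerivAt (c.y p.1) (fderivWithin ℝ c.Y (strip Te) p (0, 1)) p.2 := by
  have h1 : HasDerivWithinAt (fun s : ℝ => (p.1, s)) (0, 1) univ p.2 :=
    ((hasDerivAt_const p.2 p.1).prodMk (hasDerivAt_id p.2)).hasDerivWithinAt
  have h2 := (c.hasFDerivWithinAt hp).comp_hasDerivWithinAt p.2 h1
    (fun s _ => mem_strip.2 hp)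
  exact hasDerivWithinAt_univ.1 h2

theorem hasDerivAt_ds {t : ℝ} (ht : t ∈ Ico 0 Te) (s : ℝ) :
    HasDerivAt (c.y t) (c.ds (t, s)) s :=
  (c.fderivWithin_snd (p := (t, s)) ht).differentiableAt.hasDerivAt

theorem ds_eq {p : ℝ × ℝ} (hp : p.1 ∈ Ico 0 Te) :
    c.ds p = fderivWithin ℝ c.Y (strip Te) p (0, 1) :=
  (c.fderivWithin_snd hp).deriv

theorem fderivWithin_apply {p : ℝ × ℝ} (hp : p.1 ∈ Ico 0 Te) (q : ℝ × ℝ) :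
    fderivWithin ℝ c.Y (strip Te) p q = q.1 • c.dt p + q.2 • c.ds p := by
  rw [c.ds_eq hp, dt, ← map_smul, ← map_smul, ← map_add]
  congr 1
  ext <;> simp

theorem hasFDerivAt {p : ℝ × ℝ} (hp : p.1 ∈ Ioo 0 Te) :
    HasFDerivAt c.Y (fderivWithin ℝ c.Y (strip Te) p) p :=
  (c.hasFDerivWithinAt (Ioo_subset_Ico_self hp)).hasFDerivAt
    (prod_mem_nhds (Ico_mem_nhds hp.1 hp.2) univ_mem)

theorem hasDerivAt_dt {t : ℝ} (ht : t ∈ Ioo 0 Te) (s : ℝ) :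
    HasDerivAt (fun t => c.y t s) (c.dt (t, s)) t := by
  have h1 : HasDerivAt (fun t : ℝ => (t, s)) (1, 0) t :=
    (hasDerivAt_id t).prodMk (hasDerivAt_const t s)
  exact (c.hasFDerivAt (p := (t, s)) ht).comp_hasDerivAt t h1

theorem continuousOn_Y : ContinuousOn c.Y (strip Te) := c.contDiffOn.continuousOn

theorem continuousOn_fderivWithin :
    ContinuousOn (fderivWithin ℝ c.Y (strip Te)) (strip Te) :=
  c.contDiffOn.continuousOn_fderivWithin uniqueDiffOn_strip le_rfl

theorem continuousOn_dt : ContinuousOn c.dt (strip Te) :=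
  c.continuousOn_fderivWithin.clm_apply continuousOn_const

theorem continuousOn_ds : ContinuousOn c.ds (strip Te) :=
  (c.continuousOn_fderivWithin.clm_apply (continuousOn_const (c := ((0 : ℝ), (1 : ℝ))))).congr
    fun _ hp => c.ds_eq (mem_strip.1 hp)

theorem y_add_int {t : ℝ} (ht : t ∈ Ico 0 Te) (s : ℝ) (n : ℤ) :
    c.y t (s + n * c.period) = c.y t s :=
  ((c.simple t ht _ _).2 ⟨n, rfl⟩).symm

theorem y_add_period {t : ℝ} (ht : t ∈ Ico 0 Te) (s : ℝ) : c.y t (s + c.period) = c.y t s := by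
  simpa using c.y_add_int ht s 1

theorem ds_add_period {t : ℝ} (ht : t ∈ Ico 0 Te) (s : ℝ) :
    c.ds (t, s + c.period) = c.ds (t, s) := by
  simp only [ds]
  rw [← deriv_comp_add_const]
  congr 1
  funext r
  exact c.y_add_period ht r

theorem dt_add_period {t : ℝ} (ht : t ∈ Ico 0 Te) (s : ℝ) :
    c.dt (t, s + c.period) = c.dt (t, s) := by
  have h1 : HasFDerivWithinAt (fun p : ℝ × ℝ => p + (0, c.period))
      (ContinuousLinearMap.id ℝ (ℝ × ℝ)) (strip Te) (t, s) :=
    ((hasFDerivAt_id (t, s)).add_const _).hasFDerivWithinAt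
  have h2 : HasFDerivWithinAt c.Y (fderivWithin ℝ c.Y (strip Te) (t, s + c.period)) (strip Te)
      ((t, s) + (0, c.period)) := by
    simpa using c.hasFDerivWithinAt (p := (t, s + c.period)) ht
  have h3 := h2.comp (t, s) h1 (fun p hp => by simpa [strip] using hp)
  have h4 : HasFDerivWithinAt c.Y
      (fderivWithin ℝ c.Y (strip Te) (t, s + c.period)) (strip Te) (t, s) := by
    refine h3.congr (fun p hp => ?_) ?_
    · simpa [Y] using (c.y_add_period (mem_strip.1 hp) p.2).symm
    · simpa [Y] using (c.y_add_period ht s).symm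
  rw [dt, dt, h4.fderivWithin (uniqueDiffOn_strip _ (mem_strip.2 ht))]

theorem ds_ne_zero {t : ℝ} (ht : t ∈ Ico 0 Te) (s : ℝ) : c.ds (t, s) ≠ 0 := c.regular t ht s

theorem norm_ds_pos {t : ℝ} (ht : t ∈ Ico 0 Te) (s : ℝ) : 0 < ‖c.ds (t, s)‖ :=
  norm_pos_iff.2 (c.ds_ne_zero ht s)

theorem tangent_eq {t : ℝ} (ht : t ∈ Ico 0 Te) (s : ℝ) :
    c.tangent t (c.y t s) = ‖c.ds (t, s)‖⁻¹ • c.ds (t, s) := c.tangent_apply ht s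

theorem norm_tangent {t : ℝ} (ht : t ∈ Ico 0 Te) (s : ℝ) : ‖c.tangent t (c.y t s)‖ = 1 := by
  rw [c.tangent_eq ht, norm_smul, norm_inv, norm_norm, inv_mul_cancel₀ (c.norm_ds_pos ht s).ne']

theorem smul_tangent {t : ℝ} (ht : t ∈ Ico 0 Te) (s : ℝ) :
    ‖c.ds (t, s)‖ • c.tangent t (c.y t s) = c.ds (t, s) := by
  rw [c.tangent_eq ht, smul_smul, mul_inv_cancel₀ (c.norm_ds_pos ht s).ne', one_smul]

theorem eventually_norm_sub_le {p : ℝ × ℝ} (hp : p.1 ∈ Ico 0 Te) {κ : ℝ} (hκ : 0 < κ) :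
    ∀ᶠ q in 𝓝[strip Te] p,
      ‖c.Y q - c.Y p - ((q.1 - p.1) • c.dt p + (q.2 - p.2) • c.ds p)‖ ≤
        κ * (|q.1 - p.1| + |q.2 - p.2|) := by
  filter_upwards [(c.hasFDerivWithinAt hp).isLittleO.def hκ] with q hq
  rw [c.fderivWithin_apply hp] at hq
  refine hq.trans (mul_le_mul_of_nonneg_left ?_ hκ.le)
  rw [Prod.norm_def]
  exact max_le (le_add_of_nonneg_right (abs_nonneg _)) (le_add_of_nonneg_left (abs_nonneg _))

/-! ### Localization in the parameter -/

/-- In a neighbourhood of a point of the curve, the parameters lie in a bounded set. -/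
theorem exists_bound_of_near (hΩ : IsOpen Ω) {t₀ s₀ : ℝ} (ht₀ : t₀ ∈ Ico 0 Te) :
    ∃ R r : ℝ, 0 < r ∧ ∀ t ∈ Icc 0 ((t₀ + Te) / 2), ∀ s, ‖c.y t s - c.y t₀ s₀‖ < r →
      ∃ n : ℤ, |s + n * c.period| ≤ R := by
  rcases c.period_nonneg.eq_or_lt with hp | hp
  -- Not closed: properness applies, because times up to the midpoint of `t₀` and `Te` and a closed
  -- ball in `Ω` form a compact set. For a closed curve the parameter is reduced modulo the period.
  · obtain ⟨r, hr, hrΩ⟩ := Metric.nhds_basis_closedBall.mem_iff.1 (hΩ.mem_nhds (c.mem t₀ ht₀ s₀))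
    obtain ⟨R, hR⟩ := c.proper hp.symm
      (Icc 0 ((t₀ + Te) / 2) ×ˢ Metric.closedBall (c.y t₀ s₀) r)
      (isCompact_Icc.prod (isCompact_closedBall _ _))
      (prod_mono (fun t ht => ⟨ht.1, ht.2.trans_lt (by linarith [ht₀.2])⟩) hrΩ)
    refine ⟨R, r, hr, fun t ht s hs => ⟨0, ?_⟩⟩
    simpa using hR t s ⟨ht, by simpa [dist_eq_norm] using hs.le⟩
  · refine ⟨c.period, 1, one_pos, fun t _ s _ => ⟨-⌊s / c.period⌋, ?_⟩⟩
    have h1 := Int.floor_le (s / c.period)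
    have h2 := Int.lt_floor_add_one (s / c.period)
    rw [le_div_iff₀ hp] at h1
    rw [div_lt_iff₀ hp] at h2
    push_cast
    rw [abs_le]
    constructor <;> nlinarith

/-- Compactness: among bounded parameters whose translates all stay `δ` away from `s₀`, simplicity
of the curve at time `t₀` keeps `|t - t₀| + |y(t, s) - y(t₀, s₀)|` positive, hence above some `m >
0`. -/
theorem exists_param_near (hΩ : IsOpen Ω) {t₀ s₀ : ℝ} (ht₀ : t₀ ∈ Ico 0 Te) {δ : ℝ} (hδ : 0 < δ) :
    ∃ r : ℝ, 0 < r ∧ ∀ t ∈ Ico 0 Te, |t - t₀| < r → ∀ s, ‖c.y t s - c.y t₀ s₀‖ < r →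
      ∃ n : ℤ, |s + n * c.period - s₀| < δ := by
  obtain ⟨R, r₁, hr₁, hR⟩ := c.exists_bound_of_near hΩ (s₀ := s₀) ht₀
  set C : Set ℝ := Icc (-R) R ∩ ⋂ n : ℤ, {s | δ ≤ |s + n * c.period - s₀|} with hC
  have hCc : IsCompact C := isCompact_Icc.inter_right
    (isClosed_iInter fun n => isClosed_le continuous_const (by fun_prop))
  set A : Set (ℝ × ℝ) := Icc 0 ((t₀ + Te) / 2) ×ˢ C
  have hAc : IsCompact A := isCompact_Icc.prod hCc
  have hAS : A ⊆ strip Te := fun p hp =>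
    mem_strip.2 ⟨hp.1.1, hp.1.2.trans_lt (by linarith [ht₀.2])⟩
  have hcont : ContinuousOn (fun p : ℝ × ℝ => |p.1 - t₀| + ‖c.Y p - c.y t₀ s₀‖) A :=
    ContinuousOn.add (by fun_prop) ((c.continuousOn_Y.mono hAS).sub continuousOn_const).norm
  have hpos : ∀ p ∈ A, 0 < |p.1 - t₀| + ‖c.Y p - c.y t₀ s₀‖ := by
    intro p hp
    by_contra hle
    have h1 : |p.1 - t₀| = 0 := by linarith [abs_nonneg (p.1 - t₀), norm_nonneg (c.Y p - c.y t₀ s₀)]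
    have h2 : ‖c.Y p - c.y t₀ s₀‖ = 0 := by
      linarith [abs_nonneg (p.1 - t₀), norm_nonneg (c.Y p - c.y t₀ s₀)]
    have h3 : p.1 = t₀ := sub_eq_zero.1 (abs_eq_zero.1 h1)
    have h4 : c.y t₀ p.2 = c.y t₀ s₀ := by
      have := sub_eq_zero.1 (norm_eq_zero.1 h2)
      rwa [Y, h3] at this
    obtain ⟨n, hn⟩ := (c.simple t₀ ht₀ _ _).1 h4
    have h5 : δ ≤ |p.2 + n * c.period - s₀| := mem_iInter.1 hp.2.2 n
    rw [hn, sub_self, abs_zero] at h5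
    exact absurd hδ h5.not_gt
  obtain ⟨m, hm, hmA⟩ : ∃ m : ℝ, 0 < m ∧ ∀ p ∈ A, m ≤ |p.1 - t₀| + ‖c.Y p - c.y t₀ s₀‖ :=
    hAc.exists_forall_le' hcont hpos
  refine ⟨min (min r₁ (m / 2)) ((Te - t₀) / 2), lt_min (lt_min hr₁ (half_pos hm))
    (by linarith [ht₀.2]), fun t ht htr s hs => ?_⟩
  have ht' : t ∈ Icc 0 ((t₀ + Te) / 2) := by
    refine ⟨ht.1, ?_⟩
    have := (le_abs_self _).trans (htr.le.trans (min_le_right _ _))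
    linarith
  obtain ⟨n, hn⟩ := hR t ht' s (hs.trans_le ((min_le_left _ _).trans (min_le_left _ _)))
  by_contra! hcon
  have hmem : (t, s + n * c.period) ∈ A := by
    refine ⟨ht', abs_le.1 hn, mem_iInter.2 fun k => ?_⟩
    have := hcon (n + k)
    push_cast at this
    simpa [add_mul, add_assoc] using this
  have h1 := hmA _ hmem
  have h2 : c.Y (t, s + n * c.period) = c.y t s := c.y_add_int ht s n
  rw [h2] at h1
  have h3 := htr.trans_le ((min_le_left _ _).trans (min_le_right _ _))
  have h4 := hs.trans_le ((min_le_left _ _).trans (min_le_right _ _))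
  linarith

/-- In a neighbourhood of a point of the curve, the distance of the parameters is controlled by the
distance of the points in space-time. -/
theorem exists_param_le (hΩ : IsOpen Ω) {t₀ : ℝ} (s₀ : ℝ) (ht₀ : t₀ ∈ Ico 0 Te) :
    ∃ r C : ℝ, 0 < r ∧ 0 < C ∧ ∀ t ∈ Ico 0 Te, |t - t₀| < r → ∀ s, ‖c.y t s - c.y t₀ s₀‖ < r →
      ∃ n : ℤ, |s + n * c.period - s₀| ≤ C * (|t - t₀| + ‖c.y t s - c.y t₀ s₀‖) := by
  have hm := c.norm_ds_pos ht₀ s₀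
  set m := ‖c.ds (t₀, s₀)‖ with hmdef
  set a := ‖c.dt (t₀, s₀)‖ with hadef
  have ha : 0 ≤ a := norm_nonneg _
  -- The relative error `m / 2` is half the speed, so its share in `|σ - s₀|` is absorbed by the
  -- main term `|σ - s₀| * m`.
  obtain ⟨δ, hδ, hball⟩ := Metric.mem_nhdsWithin_iff.1
    (c.eventually_norm_sub_le (p := (t₀, s₀)) ht₀ (half_pos hm))
  obtain ⟨r, hr, hloc⟩ := c.exists_param_near hΩ (s₀ := s₀) ht₀ hδ
  refine ⟨min r δ, (a + m / 2 + 1) * (2 / m), lt_min hr hδ, by positivity, fun t ht htr s hs => ?_⟩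
  obtain ⟨n, hn⟩ := hloc t ht (htr.trans_le (min_le_left _ _)) s (hs.trans_le (min_le_left _ _))
  refine ⟨n, ?_⟩
  set σ := s + n * c.period
  have h1 : ‖c.Y (t, σ) - c.Y (t₀, s₀) - ((t - t₀) • c.dt (t₀, s₀) + (σ - s₀) • c.ds (t₀, s₀))‖ ≤
      m / 2 * (|t - t₀| + |σ - s₀|) := by
    refine hball ⟨?_, mem_strip.2 ht⟩
    rw [Metric.mem_ball, Prod.dist_eq]
    exact max_lt (htr.trans_le (min_le_right _ _)) hn
  have h2 : c.Y (t, σ) = c.y t s := c.y_add_int ht s n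
  have h3 : ‖(σ - s₀) • c.ds (t₀, s₀)‖ ≤ ‖c.y t s - c.y t₀ s₀‖ + ‖(t - t₀) • c.dt (t₀, s₀)‖ +
      m / 2 * (|t - t₀| + |σ - s₀|) := by
    rw [h2] at h1
    have : (σ - s₀) • c.ds (t₀, s₀) = (c.y t s - c.y t₀ s₀) - (t - t₀) • c.dt (t₀, s₀) -
      (c.y t s - c.Y (t₀, s₀) - ((t - t₀) • c.dt (t₀, s₀) + (σ - s₀) • c.ds (t₀, s₀))) := by
      simp only [Y]; abel
    rw [this]
    exact (norm_sub_le _ _).trans (add_le_add (norm_sub_le _ _) h1)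
  rw [norm_smul, norm_smul, Real.norm_eq_abs, Real.norm_eq_abs, ← hmdef, ← hadef] at h3
  set N := ‖c.y t s - c.y t₀ s₀‖
  have hN : 0 ≤ N := norm_nonneg _
  have h4 : |σ - s₀| * (m / 2) ≤ (a + m / 2 + 1) * (|t - t₀| + N) := by
    nlinarith [abs_nonneg (t - t₀), mul_nonneg ha hN, mul_nonneg hm.le hN]
  calc |σ - s₀| = |σ - s₀| * (m / 2) * (2 / m) := by field_simp
    _ ≤ (a + m / 2 + 1) * (|t - t₀| + N) * (2 / m) := by gcongr
    _ = _ := by ring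

/-! ### The normal velocity -/

/-- Project the first-order expansion of `y` to the normal plane: `∂_s y` is annihilated, and `x t -
x t₀` is unchanged because it already lies in the plane. Only `σ t - s₀ = O(t - t₀)` is needed, not
differentiability of `σ`. -/
theorem hasDerivWithinAt_of_param {t₀ s₀ C : ℝ} (ht₀ : t₀ ∈ Ico 0 Te) {x : ℝ → E} {σ : ℝ → ℝ}
    (hx₀ : x t₀ = c.y t₀ s₀)
    (hσ : ∀ᶠ t in 𝓝[Ico 0 Te] t₀, |σ t - s₀| ≤ C * |t - t₀| ∧ x t = c.y t (σ t) ∧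
      inner ℝ (x t - c.y t₀ s₀) (c.tangent t₀ (c.y t₀ s₀)) = 0) :
    HasDerivWithinAt x (projPerp (c.tangent t₀ (c.y t₀ s₀)) (c.dt (t₀, s₀))) (Ico 0 Te) t₀ := by
  set τ := c.tangent t₀ (c.y t₀ s₀) with hτ
  have hτ1 : ‖τ‖ = 1 := c.norm_tangent ht₀ s₀
  have hlim : Tendsto (fun t => (t, σ t)) (𝓝[Ico 0 Te] t₀) (𝓝[strip Te] (t₀, s₀)) := by
    refine tendsto_nhdsWithin_iff.2 ⟨?_, ?_⟩
    · refine (tendsto_nhdsWithin_of_tendsto_nhds tendsto_id).prodMk_nhds ?_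
      refine tendsto_iff_norm_sub_tendsto_zero.2 (squeeze_zero_norm' (a := fun t => C * |t - t₀|)
        ?_ ?_)
      · filter_upwards [hσ] with t ht
        simpa using ht.1
      · have : Continuous fun t => C * |t - t₀| := by fun_prop
        simpa using (this.tendsto t₀).mono_left nhdsWithin_le_nhds
    · filter_upwards [self_mem_nhdsWithin] with t ht using mem_strip.2 ht
  rw [hasDerivWithinAt_iff_isLittleO, Asymptotics.isLittleO_iff]
  intro ε hε
  -- The total increment `|t - t₀| + |σ t - s₀|` is at most `(1 + |C|) * |t - t₀|`.
  have hκ : 0 < ε / (1 + |C|) := by positivity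
  filter_upwards [hσ, hlim.eventually (c.eventually_norm_sub_le (p := (t₀, s₀)) ht₀ hκ)]
    with t ⟨h1, h2, h3⟩ h4
  have hP : ∀ z : E, inner ℝ τ z = 0 → projPerp τ z = z := by
    intro z hz
    rw [projPerp_eq hτ1, hz, zero_smul, sub_zero]
  have hds : projPerp τ (c.ds (t₀, s₀)) = 0 := by
    rw [← c.smul_tangent ht₀ s₀, ← hτ, projPerp_eq hτ1, real_inner_smul_right,
      real_inner_self_eq_norm_sq, hτ1]
    simp
  have key : x t - x t₀ - (t - t₀) • projPerp τ (c.dt (t₀, s₀)) =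
      projPerp τ (c.Y (t, σ t) - c.Y (t₀, s₀) -
        ((t - t₀) • c.dt (t₀, s₀) + (σ t - s₀) • c.ds (t₀, s₀))) := by
    have hz := hP (x t - x t₀) (by rw [real_inner_comm, hx₀]; exact h3)
    simp only [projPerp, map_sub, map_add, map_smul] at hz hds ⊢
    rw [hds, smul_zero, add_zero]
    simp only [Y]
    rw [← h2, ← hx₀, hz]
  rw [key]
  have hC : |σ t - s₀| ≤ |C| * |t - t₀| :=
    h1.trans (mul_le_mul_of_nonneg_right (le_abs_self _) (abs_nonneg _))
  calc _ ≤ _ := Submodule.norm_starProjection_apply_le _ _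
    _ ≤ _ := h4
    _ ≤ ε / (1 + |C|) * ((1 + |C|) * |t - t₀|) := by
      refine mul_le_mul_of_nonneg_left ?_ hκ.le
      linarith
    _ = ε * ‖t - t₀‖ := by
      rw [Real.norm_eq_abs]
      field_simp

/-- The height of `y(t, s)` over the normal plane changes sign between `s₀ - C |t - t₀|` and `s₀ + C
|t - t₀|`, so the intermediate value theorem gives an intersection point. The argument also works
one-sidedly at `t₀ = 0`. -/
theorem exists_mem_plane {t₀ : ℝ} (s₀ : ℝ) (ht₀ : t₀ ∈ Ico 0 Te) :
    ∃ C : ℝ, ∀ᶠ t in 𝓝[Ico 0 Te] t₀, ∃ s, |s - s₀| ≤ C * |t - t₀| ∧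
      inner ℝ (c.y t s - c.y t₀ s₀) (c.tangent t₀ (c.y t₀ s₀)) = 0 := by
  set τ := c.tangent t₀ (c.y t₀ s₀) with hτ
  have hτ1 : ‖τ‖ = 1 := c.norm_tangent ht₀ s₀
  have hm := c.norm_ds_pos ht₀ s₀
  set m := ‖c.ds (t₀, s₀)‖ with hmdef
  set a : ℝ := inner ℝ (c.dt (t₀, s₀)) τ with hadef
  have hdsτ : inner ℝ (c.ds (t₀, s₀)) τ = m := by
    rw [← c.smul_tangent ht₀ s₀, ← hτ, real_inner_smul_left, real_inner_self_eq_norm_sq, hτ1]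
    simp [hmdef]
  -- At the end points the height is `± C m |t - t₀|` up to `(|a| + m / 2 + C m / 2) |t - t₀|`. As
  -- `C m / 2 = |a| + m`, the sign is decided with margin `(m / 2) |t - t₀|`.
  set C : ℝ := (|a| + m) * (2 / m) with hC
  have hC0 : 0 ≤ C := by positivity
  have hCm : C * m = 2 * (|a| + m) := by rw [hC]; field_simp
  refine ⟨C, ?_⟩
  have hlim : ∀ k : ℝ, Tendsto (fun t => (t, s₀ + k * |t - t₀|)) (𝓝[Ico 0 Te] t₀)
      (𝓝[strip Te] (t₀, s₀)) := by
    intro k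
    refine tendsto_nhdsWithin_iff.2 ⟨?_, ?_⟩
    · have : Continuous fun t => (t, s₀ + k * |t - t₀|) := by fun_prop
      simpa using (this.tendsto t₀).mono_left nhdsWithin_le_nhds
    · filter_upwards [self_mem_nhdsWithin] with t ht using mem_strip.2 ht
  have hev := c.eventually_norm_sub_le (p := (t₀, s₀)) ht₀ (half_pos hm)
  filter_upwards [(hlim C).eventually hev, (hlim (-C)).eventually hev, self_mem_nhdsWithin]
    with t h1 h2 ht
  have hest : ∀ z : E, ∀ σ B : ℝ,
      ‖z - ((t - t₀) • c.dt (t₀, s₀) + σ • c.ds (t₀, s₀))‖ ≤ B →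
      |inner ℝ z τ - ((t - t₀) * a + σ * m)| ≤ B := by
    intro z σ B hB
    have : inner ℝ z τ - ((t - t₀) * a + σ * m) =
        inner ℝ (z - ((t - t₀) • c.dt (t₀, s₀) + σ • c.ds (t₀, s₀))) τ := by
      rw [inner_sub_left, inner_add_left, real_inner_smul_left, real_inner_smul_left, hdsτ]
    rw [this]
    refine (abs_real_inner_le_norm _ _).trans ?_
    rwa [hτ1, mul_one]
  have h1' := hest _ _ _ h1
  have h2' := hest _ _ _ h2
  simp only [Y, add_sub_cancel_left, abs_mul, abs_neg, abs_abs, abs_of_nonneg hC0] at h1' h2'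
  have hta : |(t - t₀) * a| ≤ |t - t₀| * |a| := (abs_mul _ _).le
  have hta' := abs_le.1 hta
  have hcy : ContinuousOn (fun s => inner ℝ (c.y t s - c.y t₀ s₀) τ)
      (Icc (s₀ + -C * |t - t₀|) (s₀ + C * |t - t₀|)) := by
    intro s _
    exact (((c.hasDerivAt_ds ht s).continuousAt.sub continuousAt_const).inner
      continuousAt_const).continuousWithinAt
  have hD : 0 ≤ C * |t - t₀| := by positivity
  have hprod : C * |t - t₀| * m = 2 * (|a| + m) * |t - t₀| := by
    rw [mul_right_comm, hCm]
  have h0 : (0 : ℝ) ∈ Icc (inner ℝ (c.y t (s₀ + -C * |t - t₀|) - c.y t₀ s₀) τ)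
      (inner ℝ (c.y t (s₀ + C * |t - t₀|) - c.y t₀ s₀) τ) := by
    have e1 := (abs_le.1 h1').1
    have e2 := (abs_le.1 h2').2
    have e3 : m / 2 * (|t - t₀| + C * |t - t₀|) = m / 2 * |t - t₀| + (|a| + m) * |t - t₀| := by
      rw [mul_add]; congr 1; linear_combination hprod / 2
    have e4 : 0 ≤ m * |t - t₀| := by positivity
    rw [e3] at e1 e2
    have e5 : -C * |t - t₀| * m = -(2 * (|a| + m) * |t - t₀|) := by
      linear_combination -hprod
    constructor <;> nlinarith
  obtain ⟨s, hs, hs0⟩ := intermediate_value_Icc (by linarith) hcy h0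
  refine ⟨s, abs_le.2 ⟨?_, ?_⟩, hs0⟩ <;> linarith [hs.1, hs.2]

/-- The normal velocity is the normal component of the velocity of the parametrization. -/
theorem hasNormalVelocity_iff (hΩ : IsOpen Ω) {t₀ : ℝ} (ht₀ : t₀ ∈ Ico 0 Te) (s₀ : ℝ) (v : E) :
    c.HasNormalVelocity t₀ (c.y t₀ s₀) v ↔
      v = projPerp (c.tangent t₀ (c.y t₀ s₀)) (c.dt (t₀, s₀)) := by
  constructor
  · rintro ⟨x, hx₀, hx, hder⟩
    obtain ⟨r, C, hr, hC, hloc⟩ := c.exists_param_le hΩ s₀ ht₀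
    obtain ⟨C₁, hC₁⟩ := hder.hasFDerivWithinAt.isBigO_sub.bound
    have hcont : ∀ᶠ t in 𝓝[Ico 0 Te] t₀, ‖x t - x t₀‖ < r := by
      have h := hder.continuousWithinAt
      exact (h.eventually (Metric.ball_mem_nhds _ hr)).mono fun t ht => by
        rwa [← dist_eq_norm]
    have hnear : ∀ᶠ t in 𝓝[Ico 0 Te] t₀, |t - t₀| < r :=
      mem_nhdsWithin_of_mem_nhds (Metric.ball_mem_nhds t₀ hr)
    -- Differentiability gives `|x t - x₀| ≤ C₁ |t - t₀|`, and the localization carries this linear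
    -- bound over to the parameters.
    have hex : ∀ᶠ t in 𝓝[Ico 0 Te] t₀, ∃ s, |s - s₀| ≤ C * (1 + C₁) * |t - t₀| ∧ x t = c.y t s ∧
        inner ℝ (x t - c.y t₀ s₀) (c.tangent t₀ (c.y t₀ s₀)) = 0 := by
      filter_upwards [hx, hC₁, hcont, hnear, self_mem_nhdsWithin] with t ⟨⟨s, hs⟩, h2⟩ h3 h4 h5 ht
      rw [hx₀] at h3 h4
      obtain ⟨n, hn⟩ := hloc t ht h5 s (by rwa [hs])
      refine ⟨s + n * c.period, hn.trans ?_, by rw [c.y_add_int ht, hs], h2⟩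
      rw [hs, mul_assoc]
      refine mul_le_mul_of_nonneg_left ?_ hC.le
      rw [Real.norm_eq_abs] at h3
      linarith
    choose! σ hσ using fun t (h : ∃ s, |s - s₀| ≤ C * (1 + C₁) * |t - t₀| ∧ x t = c.y t s ∧
        inner ℝ (x t - c.y t₀ s₀) (c.tangent t₀ (c.y t₀ s₀)) = 0) => h
    have h := c.hasDerivWithinAt_of_param ht₀ hx₀ (σ := σ) (hex.mono fun t ht => hσ t ht)
    exact (uniqueDiffOn_Ico 0 Te t₀ ht₀).eq_deriv _ hder h
  · rintro rfl
    obtain ⟨C, hC⟩ := c.exists_mem_plane s₀ ht₀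
    choose! σ hσ using fun t (h : ∃ s, |s - s₀| ≤ C * |t - t₀| ∧
      inner ℝ (c.y t s - c.y t₀ s₀) (c.tangent t₀ (c.y t₀ s₀)) = 0) => h
    have hx₀ : c.y t₀ (σ t₀) = c.y t₀ s₀ := by
      have := (hσ t₀ (hC.self_of_nhdsWithin ht₀)).1
      rw [sub_self, abs_zero, mul_zero] at this
      rw [sub_eq_zero.1 (abs_eq_zero.1 (le_antisymm this (abs_nonneg _)))]
    refine ⟨fun t => c.y t (σ t), hx₀, ?_, c.hasDerivWithinAt_of_param ht₀ hx₀ (σ := σ) (C := C) ?_⟩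
    · exact hC.mono fun t ht => ⟨⟨_, rfl⟩, (hσ t ht).2⟩
    · exact hC.mono fun t ht => ⟨(hσ t ht).1, rfl, (hσ t ht).2⟩

end MovingCurve

/-! ### Integration over a period -/

/-- A half-open interval of length `p` starting at `a`, or the whole line if `p` is not positive. -/
def periodDom (p a : ℝ) : Set ℝ := {s | 0 < p → s ∈ Ico a (a + p)}

theorem periodDom_of_pos {p : ℝ} (hp : 0 < p) (a : ℝ) : periodDom p a = Ico a (a + p) := by
  ext s; simp [periodDom, hp]

theorem periodDom_zero (a : ℝ) : periodDom 0 a = univ := by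
  ext s; simp [periodDom]

theorem measurableSet_periodDom (p a : ℝ) : MeasurableSet (periodDom p a) := by
  by_cases hp : 0 < p
  · rw [periodDom_of_pos hp]; exact measurableSet_Ico
  · have : periodDom p a = univ := by ext s; simp [periodDom, hp]
    rw [this]; exact MeasurableSet.univ

theorem setIntegral_periodDom {p : ℝ} (hp : 0 ≤ p) {F : ℝ → ℝ} (hF : ∀ s, F (s + p) = F s)
    (a a' : ℝ) : ∫ s in periodDom p a, F s = ∫ s in periodDom p a', F s := by
  rcases hp.eq_or_lt with rfl | hp
  · rw [periodDom_zero, periodDom_zero]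
  · have hF' : Function.Periodic F p := hF
    rw [periodDom_of_pos hp, periodDom_of_pos hp, integral_Ico_eq_integral_Ioo,
      integral_Ico_eq_integral_Ioo, ← integral_Ioc_eq_integral_Ioo, ← integral_Ioc_eq_integral_Ioo,
      ← intervalIntegral.integral_of_le (by linarith),
      ← intervalIntegral.integral_of_le (by linarith), hF'.intervalIntegral_add_eq a a']

theorem setIntegral_periodDom_add {p : ℝ} (hp : 0 ≤ p) {F : ℝ → ℝ} (hF : ∀ s, F (s + p) = F s)
    (a h : ℝ) : ∫ s in periodDom p a, F (s + h) = ∫ s in periodDom p a, F s := by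
  rw [setIntegral_periodDom hp hF a (a + h)]
  have hpre : (fun s => s + h) ⁻¹' periodDom p (a + h) = periodDom p a := by
    ext s
    simp only [periodDom, mem_preimage, mem_Ico, Set.mem_ofPred_eq]
    constructor
    · intro H h0; have := H h0; constructor <;> linarith [this.1, this.2]
    · intro H h0; have := H h0; constructor <;> linarith [this.1, this.2]
  rw [← hpre, (measurePreserving_add_right volume h).setIntegral_preimage_emb
    (MeasurableEquiv.addRight h).measurableEmbedding]

/-- Functions that can be integrated along a curve: periodic with period `p`, and vanishing outside
`[-R, R]` if `p = 0`. -/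
structure Admissible (p R : ℝ) (F : ℝ → ℝ) : Prop where
  periodic : ∀ s, F (s + p) = F s
  support : p = 0 → ∀ s, R < |s| → F s = 0

theorem Admissible.mono {p R R' : ℝ} {F : ℝ → ℝ} (hF : Admissible p R F) (h : R ≤ R') :
    Admissible p R' F :=
  ⟨hF.periodic, fun hp s hs => hF.support hp s (h.trans_lt hs)⟩

/-- An interval over which admissible functions can be integrated. -/
structure IsIntegrationInterval (p R α β : ℝ) : Prop where
  le : α ≤ β
  eq_zero : ∀ F, Admissible p R F → ∀ s ∈ periodDom p 0, s ∉ Icc α β → F s = 0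
  integral_eq : ∀ F, Admissible p R F → ∫ s in periodDom p 0, F s = ∫ s in α..β, F s

/-- One period `[0, p]` for a closed curve; an interval strictly containing `[-R, R]` otherwise. -/
theorem exists_isIntegrationInterval {p : ℝ} (hp : 0 ≤ p) {R : ℝ} (hR : 0 ≤ R) :
    ∃ α β, IsIntegrationInterval p R α β := by
  rcases hp.eq_or_lt with rfl | hp
  · refine ⟨-(R + 1), R + 1, ⟨by linarith, fun F hF s _ hs => ?_, fun F hF => ?_⟩⟩
    · refine hF.support rfl s ?_
      by_contra! h
      exact hs ⟨by linarith [(abs_le.1 h).1], by linarith [(abs_le.1 h).2]⟩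
    · rw [periodDom_zero, intervalIntegral.integral_of_le (by linarith)]
      refine (setIntegral_eq_of_subset_of_forall_sdiff_eq_zero MeasurableSet.univ (subset_univ _)
        fun s hs => hF.support rfl s ?_).symm ▸ rfl
      by_contra! h
      exact hs.2 ⟨by linarith [(abs_le.1 h).1], by linarith [(abs_le.1 h).2]⟩
  · refine ⟨0, p, ⟨hp.le, fun F _ s hs hs' => ?_, fun F _ => ?_⟩⟩
    · have := hs hp
      rw [zero_add] at this
      exact absurd (Ico_subset_Icc_self this) hs'
    · rw [periodDom_of_pos hp, zero_add, integral_Ico_eq_integral_Ioo,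
        ← integral_Ioc_eq_integral_Ioo, intervalIntegral.integral_of_le hp.le]

theorem IsIntegrationInterval.integrableOn {p R α β : ℝ} (h : IsIntegrationInterval p R α β)
    {F : ℝ → ℝ} (hF : Admissible p R F) (hi : IntegrableOn F (Icc α β)) :
    IntegrableOn F (periodDom p 0) := by
  have h1 : IntegrableOn F (periodDom p 0 ∩ Icc α β) := hi.mono_set inter_subset_right
  refine h1.of_forall_sdiff_eq_zero (measurableSet_periodDom p 0) fun s hs => ?_
  exact h.eq_zero F hF s hs.1 fun hs' => hs.2 ⟨hs.1, hs'⟩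

/-- Both integrals equal integrals over a full period or the whole line, which are translation
invariant. A shift by at most `1` enlarges the support radius to `R + 1`. -/
theorem IsIntegrationInterval.shift {p R α β : ℝ} (hp : 0 ≤ p)
    (h : IsIntegrationInterval p (R + 1) α β) {F : ℝ → ℝ} (hF : Admissible p R F) {k : ℝ}
    (hk : |k| ≤ 1) : ∫ s in α..β, F (s + k) = ∫ s in α..β, F s := by
  have hF' : Admissible p (R + 1) fun s => F (s + k) := by
    refine ⟨fun s => by rw [add_right_comm, hF.periodic], fun hp s hs => hF.support hp _ ?_⟩
    have := abs_sub_abs_le_abs_sub s (-k)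
    rw [abs_neg, sub_neg_eq_add] at this
    linarith
  rw [← h.integral_eq _ hF', ← h.integral_eq _ (hF.mono (by linarith)),
    setIntegral_periodDom_add hp hF.periodic]

/-- Reduction of the integral of a function of time and parameter to a rectangle. -/
theorem IsIntegrationInterval.integral_integral {p R α β : ℝ} (h : IsIntegrationInterval p R α β)
    {Te a b : ℝ} (ha : 0 < a) (hab : a ≤ b) (hb : b < Te) {H : ℝ → ℝ → ℝ}
    (hA : ∀ t ∈ Ioo 0 Te, Admissible p R (H t))
    (h0 : ∀ t ∈ Ioo 0 Te, t ∉ Ioo a b → ∀ s, H t s = 0)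
    (hi : IntegrableOn (fun q : ℝ × ℝ => H q.1 q.2) (Icc a b ×ˢ Icc α β)) :
    IntegrableOn (fun t => ∫ s in periodDom p 0, H t s) (Ioo 0 Te) ∧
      ∫ t in Ioo 0 Te, ∫ s in periodDom p 0, H t s = ∫ t in a..b, ∫ s in α..β, H t s := by
  have hsub : Ioc a b ⊆ Ioo 0 Te := fun t ht => ⟨ha.trans ht.1, ht.2.trans_lt hb⟩
  have hz : ∀ t ∈ Ioo 0 Te \ Ioc a b, ∫ s in periodDom p 0, H t s = 0 := by
    intro t ht
    simp [h0 t ht.1 (fun h => ht.2 (Ioo_subset_Ioc_self h))]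
  have heq : ∀ t ∈ Ioc a b, ∫ s in periodDom p 0, H t s = ∫ s in Ioc α β, H t s := by
    intro t ht
    rw [h.integral_eq _ (hA t (hsub ht)), intervalIntegral.integral_of_le h.le]
  have hi' : Integrable (fun q : ℝ × ℝ => H q.1 q.2)
      ((volume.restrict (Ioc a b)).prod (volume.restrict (Ioc α β))) := by
    rw [Measure.prod_restrict]
    exact hi.mono_set (prod_mono Ioc_subset_Icc_self Ioc_subset_Icc_self)
  constructor
  · refine IntegrableOn.of_forall_sdiff_eq_zero (s := Ioc a b) ?_ measurableSet_Ioo hz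
    exact (integrableOn_congr_fun heq measurableSet_Ioc).2 hi'.integral_prod_left
  · rw [setIntegral_eq_of_subset_of_forall_sdiff_eq_zero measurableSet_Ioo hsub hz,
      intervalIntegral.integral_of_le hab]
    refine setIntegral_congr_fun measurableSet_Ioc fun t ht => ?_
    rw [heq t ht, intervalIntegral.integral_of_le h.le]

namespace MovingCurve

variable {Ω : Set E} {Te : ℝ} (c : MovingCurve Ω Te)

/-! ### Integration along the curve -/

theorem dom_eq : c.dom = periodDom c.period 0 := by
  ext s; simp [dom, periodDom]

theorem injOn_dom {t : ℝ} (ht : t ∈ Ico 0 Te) : InjOn (c.y t) c.dom := by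
  intro s hs s' hs' h
  obtain ⟨n, hn⟩ := (c.simple t ht _ _).1 h
  rcases c.period_nonneg.eq_or_lt with hp | hp
  · rw [hn, ← hp]; simp
  · have h1 := hs hp
    have h2 := hs' hp
    have h3 : (n : ℝ) < 1 := by
      by_contra! h
      nlinarith [h1.1, h2.2]
    have h4 : (-1 : ℝ) < n := by
      by_contra! h
      nlinarith [h1.2, h2.1]
    have h5 : n = 0 := by
      have : n < 1 := by exact_mod_cast h3
      have : -1 < n := by exact_mod_cast h4
      omega
    rw [hn, h5]; simp

theorem continuous_y {t : ℝ} (ht : t ∈ Ico 0 Te) : Continuous (c.y t) :=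
  continuous_iff_continuousAt.2 fun s => (c.hasDerivAt_ds ht s).continuousAt

theorem continuous_ds {t : ℝ} (ht : t ∈ Ico 0 Te) : Continuous fun s => c.ds (t, s) :=
  c.continuousOn_ds.comp_continuous (continuous_const.prodMk continuous_id) fun _ => mem_strip.2 ht

/-- Arc length in the parameter. -/
def paramMeasure (t : ℝ) : Measure ℝ :=
  (volume.restrict c.dom).withDensity fun s => ENNReal.ofReal ‖c.ds (t, s)‖

theorem measurableSet_dom : MeasurableSet c.dom := by
  rw [dom_eq]; exact measurableSet_periodDom _ _

/-- On `dom` the parametrization is continuous and injective, hence a measurable embedding.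
Integrals can then be pulled back without measurability of the integrand, in particular of the
tangent field, which is defined by a choice of parameter. -/
theorem arcLength_eq {t : ℝ} (ht : t ∈ Ico 0 Te) :
    c.arcLength t = Measure.map (c.dom.domRestrict (c.y t))
      (Measure.comap Subtype.val (c.paramMeasure t)) := by
  have h1 : Measure.map Subtype.val (Measure.comap (Subtype.val : c.dom → ℝ) (c.paramMeasure t)) =
      c.paramMeasure t := by
    rw [map_comap_subtype_coe c.measurableSet_dom, paramMeasure,
      restrict_withDensity c.measurableSet_dom, Measure.restrict_restrict c.measurableSet_dom,
      inter_self]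
  have h2 : c.arcLength t = Measure.map (c.y t) (c.paramMeasure t) := rfl
  rw [h2, ← h1, Measure.map_map (c.continuous_y ht).measurable measurable_subtype_coe, h1]
  rfl

theorem measurableEmbedding {t : ℝ} (ht : t ∈ Ico 0 Te) :
    MeasurableEmbedding (c.dom.domRestrict (c.y t)) :=
  (c.continuous_y ht).continuousOn.measurableEmbedding c.measurableSet_dom (c.injOn_dom ht)

theorem paramMeasure_restrict (t : ℝ) :
    (c.paramMeasure t).restrict c.dom = c.paramMeasure t := by
  rw [paramMeasure, restrict_withDensity c.measurableSet_dom,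
    Measure.restrict_restrict c.measurableSet_dom, inter_self]

theorem measurable_density {t : ℝ} (ht : t ∈ Ico 0 Te) :
    Measurable fun s => ENNReal.ofReal ‖c.ds (t, s)‖ :=
  (c.continuous_ds ht).norm.measurable.ennreal_ofReal

theorem integral_mass (b : E) {t : ℝ} (ht : t ∈ Ico 0 Te) (h : E → ℝ) :
    ∫ x, h x ∂(c.rho b t).mass = ‖b‖ * ∫ s in c.dom, ‖c.ds (t, s)‖ * h (c.y t s) := by
  have h1 : ∫ x, h x ∂c.arcLength t = ∫ s, h (c.y t s) ∂c.paramMeasure t := by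
    rw [c.arcLength_eq ht, (c.measurableEmbedding ht).integral_map]
    have := integral_subtype_comap (μ := c.paramMeasure t) c.measurableSet_dom
      (fun s => h (c.y t s))
    rw [paramMeasure_restrict] at this
    exact this
  have h2 : (c.rho b t).mass = ENNReal.ofReal ‖b‖ • c.arcLength t := rfl
  rw [h2, integral_smul_measure, h1, paramMeasure,
    integral_withDensity_eq_integral_toReal_smul (c.measurable_density ht) (by simp)]
  simp

theorem integrable_mass {b : E} {t : ℝ} (ht : t ∈ Ico 0 Te) {h : E → ℝ}
    (hi : IntegrableOn (fun s => ‖c.ds (t, s)‖ * h (c.y t s)) c.dom) :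
    Integrable h (c.rho b t).mass := by
  have h1 : Integrable h (c.arcLength t) := by
    rw [c.arcLength_eq ht, (c.measurableEmbedding ht).integrable_map_iff]
    have h2 : Integrable (fun s => h (c.y t s)) (c.paramMeasure t) := by
      rw [paramMeasure, integrable_withDensity_iff_integrable_smul' (c.measurable_density ht)
        (by simp)]
      simpa [IntegrableOn] using hi
    rw [← paramMeasure_restrict] at h2
    exact (MeasurableEmbedding.subtype_coe c.measurableSet_dom).integrable_map_iff.1
      ((map_comap_subtype_coe c.measurableSet_dom (c.paramMeasure t)).symm ▸ h2)
  exact h1.smul_measure (by simp)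

/-- Null sets pass to the parameter because neither `|b|` nor the density `|∂_s y|` vanishes. -/
theorem ae_param_of_ae_mass {b : E} (hb : b ≠ 0) {t : ℝ} (ht : t ∈ Ico 0 Te) {P : E → Prop}
    (h : ∀ᵐ x ∂(c.rho b t).mass, P x) : ∀ᵐ s ∂volume.restrict c.dom, P (c.y t s) := by
  have h1 : ∀ᵐ x ∂c.arcLength t, P x := by
    have h2 : (c.rho b t).mass = ENNReal.ofReal ‖b‖ • c.arcLength t := rfl
    rw [h2, Measure.ae_ennreal_smul_measure_iff (by simpa using hb)] at h
    exact h
  have h3 : ∀ᵐ s ∂c.paramMeasure t, P (c.y t s) :=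
    ae_of_ae_map (c.continuous_y ht).aemeasurable h1
  rw [paramMeasure, ae_withDensity_iff (c.measurable_density ht)] at h3
  filter_upwards [h3] with s hs
  exact hs (by simpa using c.ds_ne_zero ht s)

end MovingCurve

/-! ### Test fields -/

namespace IsTestField

variable {Ω : Set E} {Te : ℝ} {φ : ℝ → E → E}

/-- The derivative of a time-dependent field on space-time. -/
def D (φ : ℝ → E → E) (p : ℝ × E) : ℝ × E →L[ℝ] E := fderiv ℝ (fun p : ℝ × E => φ p.1 p.2) p

theorem continuous (hφ : IsTestField Ω Te φ) : Continuous fun p : ℝ × E => φ p.1 p.2 :=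
  hφ.smooth.continuous

theorem continuous_D (hφ : IsTestField Ω Te φ) : Continuous (D φ) :=
  hφ.smooth.continuous_fderiv (by simp)

theorem hasFDerivAt (hφ : IsTestField Ω Te φ) (p : ℝ × E) :
    HasFDerivAt (fun p : ℝ × E => φ p.1 p.2) (D φ p) p :=
  (hφ.smooth.differentiable (by simp) p).hasFDerivAt

theorem deriv_eq (hφ : IsTestField Ω Te φ) (t : ℝ) (x : E) :
    deriv (fun s => φ s x) t = D φ (t, x) (1, 0) := by
  have h1 : HasDerivAt (fun t : ℝ => (t, x)) (1, 0) t :=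
    (hasDerivAt_id t).prodMk (hasDerivAt_const t x)
  exact ((hφ.hasFDerivAt (t, x)).comp_hasDerivAt t h1).deriv

theorem rot_eq (hφ : IsTestField Ω Te φ) (t : ℝ) (x : E) :
    rot (φ t) x = rotL ((D φ (t, x)).comp (ContinuousLinearMap.inr ℝ ℝ E)) := by
  have h1 : HasFDerivAt (fun x : E => (t, x)) (ContinuousLinearMap.inr ℝ ℝ E) x :=
    hasFDerivAt_prodMk_right t x
  rw [Dislocation.rot_eq]
  congr 1
  exact ((hφ.hasFDerivAt (t, x)).comp x h1).fderiv

theorem eq_zero {p : ℝ × E} (hp : p ∉ tsupport fun p : ℝ × E => φ p.1 p.2) : φ p.1 p.2 = 0 :=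
  image_eq_zero_of_notMem_tsupport (f := fun p : ℝ × E => φ p.1 p.2) hp

theorem D_eq_zero {p : ℝ × E} (hp : p ∉ tsupport fun p : ℝ × E => φ p.1 p.2) : D φ p = 0 :=
  image_eq_zero_of_notMem_tsupport fun h => hp (tsupport_fderiv_subset ℝ h)

theorem continuous_rot (hφ : IsTestField Ω Te φ) :
    Continuous fun p : ℝ × E => rot (φ p.1) p.2 := by
  simp only [hφ.rot_eq]
  exact rotL.continuous.comp (hφ.continuous_D.clm_comp continuous_const)

theorem exists_time_interval (hφ : IsTestField Ω Te φ) (hTe : 0 < Te) :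
    ∃ a b : ℝ, 0 < a ∧ a < b ∧ b < Te ∧
      ∀ p ∈ tsupport (fun p : ℝ × E => φ p.1 p.2), p.1 ∈ Ioo a b := by
  -- The extra point keeps `K` nonempty when `φ = 0`.
  set K : Set ℝ := insert (Te / 2) (Prod.fst '' tsupport fun p : ℝ × E => φ p.1 p.2) with hK
  have hKc : IsCompact K := (hφ.compact.isCompact.image continuous_fst).insert _
  have hKs : K ⊆ Ioo 0 Te := by
    refine insert_subset ⟨by linarith, by linarith⟩ ?_
    rintro _ ⟨p, hp, rfl⟩
    exact (hφ.supp hp).1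
  have hne : K.Nonempty := insert_nonempty _ _
  obtain ⟨m, hmK, hm⟩ := hKc.exists_isLeast hne
  obtain ⟨M, hMK, hM⟩ := hKc.exists_isGreatest hne
  have h1 := hKs hmK
  have h2 := hKs hMK
  have h3 := hm hMK
  refine ⟨m / 2, (M + Te) / 2, by linarith [h1.1], by linarith [h1.1, h2.2], by linarith [h2.2],
    fun p hp => ?_⟩
  have hpK : p.1 ∈ K := mem_insert_of_mem _ ⟨p, hp, rfl⟩
  have h4 := hm hpK
  have h5 := hM hpK
  exact ⟨by linarith [h1.1], by linarith [h2.2]⟩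

end IsTestField

/-! ### Integrability of the flux -/

theorem continuous_app (b : E) : Continuous fun S : Sym3 => app S b := by
  unfold app
  exact (PiLp.continuous_toLp 2 _).comp
    (Continuous.matrix_mulVec continuous_subtype_val continuous_const)

/-- The flux may jump where `b × Q = 0`, so integrability rests on measurability and boundedness
instead of continuity. -/
theorem integrableOn_flux (b : E) {f : ℝ → ℝ} (hf : Continuous f) {X : Type*} [TopologicalSpace X]
    [T2Space X] [MeasurableSpace X] [OpensMeasurableSpace X] {μ : Measure X}
    [IsFiniteMeasureOnCompacts μ] {K : Set X} (hK : IsCompact K) {P Q r : X → E}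
    (hP : ContinuousOn P K) (hQ : ContinuousOn Q K) (hr : ContinuousOn r K) :
    IntegrableOn (fun x => ‖Q x‖ * inner ℝ (fluxFn b f (P x) (Q x)) (r x)) K μ := by
  have hKm : MeasurableSet K := hK.measurableSet
  obtain ⟨M, hM⟩ := hK.exists_bound_of_continuousOn hP
  obtain ⟨C, hC, hflux⟩ := exists_norm_fluxFn_le b hf M
  obtain ⟨N, hN⟩ := hK.exists_bound_of_continuousOn (hQ.norm.mul hr.norm)
  have : IsFiniteMeasure (μ.restrict K) := isFiniteMeasure_restrict.2 hK.measure_ne_top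
  refine Integrable.of_bound (C := C * N) ?_ ?_
  · have mP := hP.aemeasurable (μ := μ) hKm
    have mQ := hQ.aemeasurable (μ := μ) hKm
    have mr := hr.aemeasurable (μ := μ) hKm
    have h1 : AEMeasurable (fun x => fluxFn b f (P x) (Q x)) (μ.restrict K) :=
      Measurable.comp_aemeasurable (g := fun p : E × E => fluxFn b f p.1 p.2)
        (f := fun x => (P x, Q x)) (measurable_fluxFn b hf) (mP.prodMk mQ)
    have h2 : AEMeasurable (fun x => (inner ℝ (fluxFn b f (P x) (Q x)) (r x) : ℝ))
      (μ.restrict K) := h1.inner mr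
    exact (mQ.norm.mul h2).aestronglyMeasurable
  · filter_upwards [ae_restrict_mem hKm] with x hx
    have h1 : ‖Q x‖ * ‖r x‖ ≤ N := (le_abs_self _).trans (hN x hx)
    have h2 := norm_inner_le_norm (𝕜 := ℝ) (fluxFn b f (P x) (Q x)) (r x)
    have h3 := hflux _ (Q x) (hM x hx)
    rw [norm_mul, norm_norm]
    calc _ ≤ ‖Q x‖ * (‖fluxFn b f (P x) (Q x)‖ * ‖r x‖) := by gcongr
      _ = ‖fluxFn b f (P x) (Q x)‖ * (‖Q x‖ * ‖r x‖) := by ring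
      _ ≤ C * N := mul_le_mul h3 h1 (by positivity) hC

namespace MovingCurve

variable {Ω : Set E} {Te : ℝ} (c : MovingCurve Ω Te) {φ : ℝ → E → E}

/-! ### The weak form of the transport identity -/

theorem exists_param_bound (hφ : IsTestField Ω Te φ) :
    ∃ R : ℝ, 0 ≤ R ∧ (c.period = 0 → ∀ t s,
      (t, c.y t s) ∈ tsupport (fun p : ℝ × E => φ p.1 p.2) → |s| ≤ R) := by
  by_cases hp : c.period = 0
  · obtain ⟨R, hR⟩ := c.proper hp _ hφ.compact.isCompact
      (hφ.supp.trans (prod_mono Ioo_subset_Ico_self subset_rfl))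
    exact ⟨max R 0, le_max_right _ _, fun _ t s h => (hR t s h).trans (le_max_left _ _)⟩
  · exact ⟨0, le_rfl, fun h => absurd h hp⟩

theorem continuousOn_graph : ContinuousOn (fun q : ℝ × ℝ => (q.1, c.Y q)) (strip Te) :=
  continuousOn_fst.prodMk c.continuousOn_Y

/-- The integrand is `g_t · y_s - g_s · y_t` for `g(t, s) = φ(t, y(t, s))`, and
`integral_inner_partials_eq_zero` applies to `g` and `y`. -/
theorem integral_transport (hφ : IsTestField Ω Te φ) {R : ℝ}
    (hR : c.period = 0 → ∀ t s,
      (t, c.y t s) ∈ tsupport (fun p : ℝ × E => φ p.1 p.2) → |s| ≤ R) {a b α β : ℝ}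
    (ha : 0 < a) (hab : a < b) (hb : b < Te)
    (hK : ∀ p ∈ tsupport (fun p : ℝ × E => φ p.1 p.2), p.1 ∈ Ioo a b)
    (hI : IsIntegrationInterval c.period (R + 1) α β) :
    ∫ t in a..b, ∫ s in α..β,
      (inner ℝ (c.ds (t, s)) (deriv (fun r => φ r (c.y t s)) t) +
        inner ℝ (rot (φ t) (c.y t s)) (cross (c.dt (t, s)) (c.ds (t, s))) : ℝ) = 0 := by
  -- Continuity is known on the strip only. Clamping the time to `[a, b]` gives maps continuous on
  -- the whole plane and unchanged over `[a, b]`.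
  set cl : ℝ × ℝ → ℝ × ℝ := fun q => (projIcc a b hab.le q.1, q.2) with hcl
  have ccl : Continuous cl :=
    (continuous_subtype_val.comp (continuous_projIcc.comp continuous_fst)).prodMk continuous_snd
  have hsub : Icc a b ⊆ Ioo 0 Te := fun t ht => ⟨ha.trans_le ht.1, ht.2.trans_lt hb⟩
  have hcls : ∀ q, cl q ∈ strip Te := fun q =>
    mem_strip.2 (Ioo_subset_Ico_self (hsub (projIcc a b hab.le q.1).2))
  have hclI : ∀ t ∈ Icc a b, ∀ s, cl (t, s) = (t, s) := fun t ht s => by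
    simp [hcl, projIcc_of_mem hab.le ht]
  have lift : ∀ {F : ℝ × ℝ → E}, ContinuousOn F (strip Te) → Continuous fun q => F (cl q) :=
    fun hF => hF.comp_continuous ccl hcls
  set g : ℝ × ℝ → E := fun q => φ q.1 (c.Y q) with hg
  set gt : ℝ × ℝ → E := fun q => IsTestField.D φ (q.1, c.Y q) (1, c.dt q) with hgt
  set gs : ℝ × ℝ → E := fun q => IsTestField.D φ (q.1, c.Y q) (0, c.ds q) with hgs
  have cg : ContinuousOn g (strip Te) := hφ.continuous.comp_continuousOn c.continuousOn_graph
  have cD := hφ.continuous_D.comp_continuousOn c.continuousOn_graph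
  have cgt : ContinuousOn gt (strip Te) :=
    cD.clm_apply (continuousOn_const.prodMk c.continuousOn_dt)
  have cgs : ContinuousOn gs (strip Te) :=
    cD.clm_apply (continuousOn_const.prodMk c.continuousOn_ds)
  have dg_t : ∀ t ∈ Ioo 0 Te, ∀ s, HasDerivAt (fun t => g (t, s)) (gt (t, s)) t := by
    intro t ht s
    exact (hφ.hasFDerivAt (t, c.y t s)).comp_hasDerivAt t
      ((hasDerivAt_id t).prodMk (c.hasDerivAt_dt ht s))
  have dg_s : ∀ t ∈ Ioo 0 Te, ∀ s, HasDerivAt (fun s => g (t, s)) (gs (t, s)) s := by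
    intro t ht s
    exact (hφ.hasFDerivAt (t, c.y t s)).comp_hasDerivAt s
      ((hasDerivAt_const s t).prodMk (c.hasDerivAt_ds (Ioo_subset_Ico_self ht) s))
  have clamp_t : ∀ {F : ℝ × ℝ → E} {F' : E} {t s : ℝ}, t ∈ Ioo a b →
      HasDerivAt (fun t => F (t, s)) F' t → HasDerivAt (fun t => F (cl (t, s))) F' t := by
    intro F F' t s ht hF
    refine hF.congr_of_eventuallyEq ?_
    filter_upwards [Ioo_mem_nhds ht.1 ht.2] with r hr
    rw [hclI r (Ioo_subset_Icc_self hr)]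
  have key := integral_inner_partials_eq_zero (α := α) (β := β)
    (G := fun t s => g (cl (t, s))) (Y := fun t s => c.Y (cl (t, s)))
    (Gt := fun t s => gt (cl (t, s))) (Gs := fun t s => gs (cl (t, s)))
    (Yt := fun t s => c.dt (cl (t, s))) (Ys := fun t s => c.ds (cl (t, s)))
    hab.le (lift cg) (lift c.continuousOn_Y) (lift cgt) (lift cgs) (lift c.continuousOn_dt)
    (lift c.continuousOn_ds) ?_ ?_ ?_ ?_ ?_ ?_ ?_
  · rw [← key]
    refine intervalIntegral.integral_congr fun t ht => ?_
    rw [uIcc_of_le hab.le] at ht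
    refine intervalIntegral.integral_congr fun s _ => ?_
    beta_reduce
    rw [hclI t ht, hφ.deriv_eq, hφ.rot_eq, inner_rotL_cross]
    have h1 : gt (t, s) = IsTestField.D φ (t, c.y t s) (1, 0) +
        IsTestField.D φ (t, c.y t s) (0, c.dt (t, s)) := by
      rw [hgt, ← map_add]; simp [Y]
    rw [h1, inner_add_left, real_inner_comm]
    simp only [hgs, Y, ContinuousLinearMap.comp_apply, ContinuousLinearMap.inr_apply]
    ring
  · intro t ht s
    rw [hclI t (Ioo_subset_Icc_self ht)]
    exact clamp_t ht (dg_t t (hsub (Ioo_subset_Icc_self ht)) s)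
  · intro t ht s
    rw [hclI t (Ioo_subset_Icc_self ht)]
    exact clamp_t ht (c.hasDerivAt_dt (hsub (Ioo_subset_Icc_self ht)) s)
  · intro t ht s
    simp only [hclI t ht]
    exact dg_s t (hsub ht) s
  · intro t ht s
    simp only [hclI t ht]
    exact c.hasDerivAt_ds (Ioo_subset_Ico_self (hsub ht)) s
  · intro s
    rw [hclI a (left_mem_Icc.2 hab.le)]
    exact IsTestField.eq_zero (p := (a, c.y a s)) fun h => (hK _ h).1.false
  · intro s
    rw [hclI b (right_mem_Icc.2 hab.le)]
    exact IsTestField.eq_zero (p := (b, c.y b s)) fun h => (hK _ h).2.false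
  · intro t ht h hh
    simp only [hclI t ht]
    have htI := Ioo_subset_Ico_self (hsub ht)
    -- Shift invariance comes from periodicity on a closed curve, and otherwise from `φ` vanishing
    -- along the curve for `|s| > R`.
    have hA : Admissible c.period R fun s => (inner ℝ (g (t, s)) (c.dt (t, s + h)) : ℝ) := by
      refine ⟨fun s => ?_, fun hp s hs => ?_⟩
      · rw [add_right_comm, c.dt_add_period htI]
        simp only [hg, Y]
        rw [c.y_add_period htI]
      · have : g (t, s) = 0 := IsTestField.eq_zero (p := (t, c.y t s)) fun h =>
          (hR hp t s h).not_gt hs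
        rw [this, inner_zero_left]
    have := hI.shift c.period_nonneg hA (k := -h) (by rwa [abs_neg])
    rw [← this]
    refine intervalIntegral.integral_congr fun s _ => ?_
    rw [neg_add_cancel_right, sub_eq_add_neg]

/-- The stress vector `T b` along the curve. -/
def traction (T : ℝ → E → Sym3) (b : E) (q : ℝ × ℝ) : E := app (T q.1 (c.Y q)) b

theorem continuousOn_traction {T : ℝ → E → Sym3}
    (hT : ContinuousOn (fun p : ℝ × E => T p.1 p.2) (Icc 0 Te ×ˢ closure Ω)) (b : E) :
    ContinuousOn (c.traction T b) (strip Te) := by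
  refine (continuous_app b).comp_continuousOn (hT.comp c.continuousOn_graph fun q hq => ?_)
  have hq' := mem_strip.1 hq
  exact ⟨Ico_subset_Icc_self hq', subset_closure (c.mem _ hq' _)⟩

/-- The difference of the two sides of the law of motion, rotated by the tangent and weighted with
the length element. -/
def defect (T : ℝ → E → Sym3) (b : E) (f : ℝ → ℝ) (q : ℝ × ℝ) : E :=
  cross (c.dt q) (c.ds q) - ‖c.ds q‖ • fluxFn b f (c.traction T b q) (c.ds q)

theorem slipFlux_tangent (b : E) (f : ℝ → ℝ) (T : ℝ → E → Sym3) {t : ℝ} (ht : t ∈ Ico 0 Te)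
    (s : ℝ) : slipFlux b f (T t (c.y t s)) (c.tangent t (c.y t s)) =
      fluxFn b f (c.traction T b (t, s)) (c.ds (t, s)) := by
  rw [slipFlux_eq, c.tangent_eq ht, fluxFn_smul _ _ _ _ (inv_pos.2 (c.norm_ds_pos ht s))]
  rfl

set_option maxHeartbeats 1000000 in
/-- For a moving curve the evolution equation says that the defect is orthogonal to the rotations of
all test fields. -/
theorem solvesEvolution_iff {b : E} (hb : b ≠ 0) {f : ℝ → ℝ} (hf : Continuous f) (hTe : 0 < Te)
    {T : ℝ → E → Sym3}
    (hT : ContinuousOn (fun p : ℝ × E => T p.1 p.2) (Icc 0 Te ×ˢ closure Ω)) :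
    SolvesEvolution Ω Te b f T (c.rho b) ↔ ∀ φ : ℝ → E → E, IsTestField Ω Te φ →
      ∫ t in Ioo 0 Te, ∫ s in c.dom, inner ℝ (rot (φ t) (c.y t s)) (c.defect T b f (t, s)) = 0 := by
  refine forall₂_congr fun φ hφ => ?_
  obtain ⟨a, a', ha, haa, ha', hK⟩ := hφ.exists_time_interval hTe
  obtain ⟨R, hR0, hR⟩ := c.exists_param_bound hφ
  -- The extra `1` leaves room for the unit shifts in `integral_transport`.
  obtain ⟨α, β, hI⟩ := exists_isIntegrationInterval c.period_nonneg (R := R + 1) (by linarith)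
  -- Up to the factor `|b|`, the equation reads `-∫∫ H₁ = ∫∫ H₃`. Transport gives `∫∫ H₁ + ∫∫ H₂ =
  -- 0`, and `H₂ - H₃` is the product of `rot φ` with the defect.
  obtain ⟨H₁, hH₁⟩ : ∃ H : ℝ → ℝ → ℝ, ∀ t s, H t s =
    inner ℝ (c.ds (t, s)) (deriv (fun r => φ r (c.y t s)) t) := ⟨_, fun _ _ => rfl⟩
  obtain ⟨H₂, hH₂⟩ : ∃ H : ℝ → ℝ → ℝ, ∀ t s, H t s =
    inner ℝ (rot (φ t) (c.y t s)) (cross (c.dt (t, s)) (c.ds (t, s))) := ⟨_, fun _ _ => rfl⟩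
  obtain ⟨H₃, hH₃⟩ : ∃ H : ℝ → ℝ → ℝ, ∀ t s, H t s = ‖c.ds (t, s)‖ *
    inner ℝ (fluxFn b f (c.traction T b (t, s)) (c.ds (t, s))) (rot (φ t) (c.y t s)) :=
      ⟨_, fun _ _ => rfl⟩
  have hIco : ∀ {t}, t ∈ Ioo 0 Te → t ∈ Ico 0 Te := fun h => Ioo_subset_Ico_self h
  have z_t : ∀ {p : ℝ × E}, p ∉ tsupport (fun p : ℝ × E => φ p.1 p.2) →
      deriv (fun r => φ r p.2) p.1 = 0 := fun {p} hp => by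
    rw [hφ.deriv_eq, IsTestField.D_eq_zero hp]; rfl
  have z_x : ∀ {p : ℝ × E}, p ∉ tsupport (fun p : ℝ × E => φ p.1 p.2) →
      rot (φ p.1) p.2 = 0 := fun {p} hp => by
    rw [hφ.rot_eq, IsTestField.D_eq_zero hp, ContinuousLinearMap.zero_comp, map_zero]
  have per_y : ∀ {t}, t ∈ Ioo 0 Te → ∀ s, c.y t (s + c.period) = c.y t s :=
    fun ht s => c.y_add_period (hIco ht) s
  have out : c.period = 0 → ∀ t s, R + 1 < |s| →
      (t, c.y t s) ∉ tsupport (fun p : ℝ × E => φ p.1 p.2) :=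
    fun hp t s hs h => by linarith [hR hp t s h]
  have A₁ : ∀ t ∈ Ioo 0 Te, Admissible c.period (R + 1) (H₁ t) := fun t ht =>
    ⟨fun s => by simp only [hH₁]; rw [c.ds_add_period (hIco ht), per_y ht],
      fun hp s hs => by simp only [hH₁]; rw [z_t (out hp t s hs), inner_zero_right]⟩
  have A₂ : ∀ t ∈ Ioo 0 Te, Admissible c.period (R + 1) (H₂ t) := fun t ht =>
    ⟨fun s => by
      simp only [hH₂]; rw [c.ds_add_period (hIco ht), c.dt_add_period (hIco ht), per_y ht],
      fun hp s hs => by simp only [hH₂]; rw [z_x (out hp t s hs), inner_zero_left]⟩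
  have A₃ : ∀ t ∈ Ioo 0 Te, Admissible c.period (R + 1) (H₃ t) := fun t ht =>
    ⟨fun s => by simp only [hH₃, traction, Y]; rw [c.ds_add_period (hIco ht), per_y ht],
      fun hp s hs => by simp only [hH₃]; rw [z_x (out hp t s hs), inner_zero_right, mul_zero]⟩
  have outT : ∀ t, t ∉ Ioo a a' → ∀ s, (t, c.y t s) ∉ tsupport (fun p : ℝ × E => φ p.1 p.2) :=
    fun t ht s h => ht (hK _ h)
  have Z₁ : ∀ t ∈ Ioo 0 Te, t ∉ Ioo a a' → ∀ s, H₁ t s = 0 := fun t _ ht s => by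
    simp only [hH₁]; rw [z_t (outT t ht s), inner_zero_right]
  have Z₂ : ∀ t ∈ Ioo 0 Te, t ∉ Ioo a a' → ∀ s, H₂ t s = 0 := fun t _ ht s => by
    simp only [hH₂]; rw [z_x (outT t ht s), inner_zero_left]
  have Z₃ : ∀ t ∈ Ioo 0 Te, t ∉ Ioo a a' → ∀ s, H₃ t s = 0 := fun t _ ht s => by
    simp only [hH₃]; rw [z_x (outT t ht s), inner_zero_right, mul_zero]
  have hrect : Icc a a' ×ˢ Icc α β ⊆ strip Te := fun q hq =>
    mem_strip.2 ⟨ha.le.trans hq.1.1, hq.1.2.trans_lt ha'⟩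
  have crot : ContinuousOn (fun q : ℝ × ℝ => rot (φ q.1) (c.Y q)) (strip Te) :=
    hφ.continuous_rot.comp_continuousOn c.continuousOn_graph
  have C₁ : ContinuousOn (fun q : ℝ × ℝ => H₁ q.1 q.2) (strip Te) := by
    simp only [hH₁, hφ.deriv_eq]
    exact c.continuousOn_ds.inner
      ((hφ.continuous_D.comp_continuousOn c.continuousOn_graph).clm_apply continuousOn_const)
  have C₂ : ContinuousOn (fun q : ℝ × ℝ => H₂ q.1 q.2) (strip Te) := by
    simp only [hH₂]
    exact crot.inner (continuous_cross.comp_continuousOn (c.continuousOn_dt.prodMk c.continuousOn_ds))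
  have cT := c.continuousOn_traction hT b
  have hKc : IsCompact (Icc a a' ×ˢ Icc α β) := isCompact_Icc.prod isCompact_Icc
  have I₁ := hI.integral_integral ha haa.le ha' A₁ Z₁ ((C₁.mono hrect).integrableOn_compact hKc)
  have I₂ := hI.integral_integral ha haa.le ha' A₂ Z₂ ((C₂.mono hrect).integrableOn_compact hKc)
  have I₃ := hI.integral_integral ha haa.le ha' A₃ Z₃ <| by
    simp only [hH₃]
    exact integrableOn_flux b hf hKc (cT.mono hrect) (c.continuousOn_ds.mono hrect) (crot.mono hrect)
  have hslice : ∀ {F : ℝ × ℝ → E} {t : ℝ}, ContinuousOn F (strip Te) → t ∈ Ioo 0 Te →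
      Continuous fun s => F (t, s) := fun hF ht =>
    hF.comp_continuous (continuous_const.prodMk continuous_id) fun _ => mem_strip.2 (hIco ht)
  have J₁ : ∀ t ∈ Ioo 0 Te, IntegrableOn (H₁ t) c.dom := fun t ht => by
    rw [dom_eq]
    refine hI.integrableOn (A₁ t ht) (Continuous.integrableOn_Icc ?_)
    exact C₁.comp_continuous (continuous_const.prodMk continuous_id) fun _ => mem_strip.2 (hIco ht)
  have J₂ : ∀ t ∈ Ioo 0 Te, IntegrableOn (H₂ t) c.dom := fun t ht => by
    rw [dom_eq]
    refine hI.integrableOn (A₂ t ht) (Continuous.integrableOn_Icc ?_)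
    exact C₂.comp_continuous (continuous_const.prodMk continuous_id) fun _ => mem_strip.2 (hIco ht)
  have J₃ : ∀ t ∈ Ioo 0 Te, IntegrableOn (H₃ t) c.dom := fun t ht => by
    rw [dom_eq]
    refine hI.integrableOn (A₃ t ht) ?_
    have hH : H₃ t = fun s => ‖c.ds (t, s)‖ *
      inner ℝ (fluxFn b f (c.traction T b (t, s)) (c.ds (t, s))) (rot (φ t) (c.y t s)) :=
      funext fun s => hH₃ t s
    rw [hH]
    exact (integrableOn_flux b hf isCompact_Icc
      (hslice cT ht).continuousOn (hslice c.continuousOn_ds ht).continuousOn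
      (hslice crot ht).continuousOn)
  have E₁ : ∀ t ∈ Ioo 0 Te, ∀ s, ‖c.ds (t, s)‖ *
      inner ℝ ((c.rho b t).dir (c.y t s)) (deriv (fun r => φ r (c.y t s)) t) = H₁ t s := by
    intro t ht s
    rw [← real_inner_smul_left]
    simp only [rho, hH₁]
    rw [c.smul_tangent (hIco ht)]
  have E₃ : ∀ t ∈ Ioo 0 Te, ∀ s, ‖c.ds (t, s)‖ *
      inner ℝ (slipFlux b f (T t (c.y t s)) ((c.rho b t).dir (c.y t s))) (rot (φ t) (c.y t s)) =
        H₃ t s := by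
    intro t ht s
    simp only [rho, hH₃]
    rw [c.slipFlux_tangent b f T (hIco ht)]
  have M₁ : ∀ t ∈ Ioo 0 Te,
      ∫ x, inner ℝ ((c.rho b t).dir x) (deriv (fun s => φ s x) t) ∂(c.rho b t).mass =
        ‖b‖ * ∫ s in c.dom, H₁ t s := by
    intro t ht
    rw [c.integral_mass b (hIco ht)]
    simp only [E₁ t ht]
  have M₃ : ∀ t ∈ Ioo 0 Te,
      ∫ x, inner ℝ (slipFlux b f (T t x) ((c.rho b t).dir x)) (rot (φ t) x) ∂(c.rho b t).mass =
        ‖b‖ * ∫ s in c.dom, H₃ t s := by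
    intro t ht
    rw [c.integral_mass b (hIco ht)]
    simp only [E₃ t ht]
  rw [← dom_eq] at I₁ I₂ I₃
  have transport : (∫ t in Ioo 0 Te, ∫ s in c.dom, H₁ t s) +
      ∫ t in Ioo 0 Te, ∫ s in c.dom, H₂ t s = 0 := by
    have h := c.integral_transport hφ hR ha haa ha' hK hI
    have hs : ∀ {F : ℝ → ℝ → ℝ}, ContinuousOn (fun q : ℝ × ℝ => F q.1 q.2) (strip Te) →
        ∀ t ∈ Icc a a', IntervalIntegrable (F t) volume α β := fun hF t ht =>
      (hF.comp_continuous (continuous_const.prodMk continuous_id) fun _ =>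
        mem_strip.2 ⟨ha.le.trans ht.1, ht.2.trans_lt ha'⟩).intervalIntegrable _ _
    have ht : ∀ {F : ℝ → ℝ → ℝ}, ContinuousOn (fun q : ℝ × ℝ => F q.1 q.2) (strip Te) →
        IntervalIntegrable (fun t => ∫ s in α..β, F t s) volume a a' := by
      intro F hF
      have hi : Integrable (fun q : ℝ × ℝ => F q.1 q.2)
          ((volume.restrict (Ioc a a')).prod (volume.restrict (Ioc α β))) := by
        rw [Measure.prod_restrict]
        exact ((hF.mono hrect).integrableOn_compact hKc).mono_set
          (prod_mono Ioc_subset_Icc_self Ioc_subset_Icc_self)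
      rw [intervalIntegrable_iff_integrableOn_Ioc_of_le haa.le]
      simp only [intervalIntegral.integral_of_le hI.le]
      exact hi.integral_prod_left
    simp only [← hH₁, ← hH₂] at h
    rw [I₁.2, I₂.2, ← intervalIntegral.integral_add (ht C₁) (ht C₂), ← h]
    refine intervalIntegral.integral_congr fun t htt => ?_
    rw [uIcc_of_le haa.le] at htt
    exact (intervalIntegral.integral_add (hs C₁ t htt) (hs C₂ t htt)).symm
  have hdef : ∫ t in Ioo 0 Te, ∫ s in c.dom,
      inner ℝ (rot (φ t) (c.y t s)) (c.defect T b f (t, s)) =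
      (∫ t in Ioo 0 Te, ∫ s in c.dom, H₂ t s) - ∫ t in Ioo 0 Te, ∫ s in c.dom, H₃ t s := by
    rw [← integral_sub I₂.1 I₃.1]
    refine setIntegral_congr_fun measurableSet_Ioo fun t ht => ?_
    rw [← integral_sub (J₂ t ht) (J₃ t ht)]
    congr 1
    funext s
    simp only [defect, hH₂, hH₃]
    rw [inner_sub_right, real_inner_smul_right, real_inner_comm (rot (φ t) (c.y t s))
      (fluxFn _ _ _ _)]
  have L₁ : ∫ t in Ioo 0 Te,
      ∫ x, inner ℝ ((c.rho b t).dir x) (deriv (fun s => φ s x) t) ∂(c.rho b t).mass =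
        ‖b‖ * ∫ t in Ioo 0 Te, ∫ s in c.dom, H₁ t s := by
    rw [← integral_const_mul]
    exact setIntegral_congr_fun measurableSet_Ioo fun t ht => M₁ t ht
  have L₃ : ∫ t in Ioo 0 Te, ∫ x, inner ℝ (slipFlux b f (T t x) ((c.rho b t).dir x))
      (rot (φ t) x) ∂(c.rho b t).mass = ‖b‖ * ∫ t in Ioo 0 Te, ∫ s in c.dom, H₃ t s := by
    rw [← integral_const_mul]
    exact setIntegral_congr_fun measurableSet_Ioo fun t ht => M₃ t ht
  have hbn : ‖b‖ ≠ 0 := norm_ne_zero_iff.2 hb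
  rw [hdef]
  constructor
  · rintro ⟨-, -, -, h⟩
    rw [L₁, L₃, ← mul_neg] at h
    have := mul_left_cancel₀ hbn h
    linarith
  -- The existence of all integrals must be supplied here; it comes from continuity, or boundedness
  -- of the flux, on the integration rectangle.
  · intro h
    refine ⟨fun t ht => ⟨c.integrable_mass (hIco ht) ?_, c.integrable_mass (hIco ht) ?_⟩, ?_, ?_, ?_⟩
    · simpa only [E₁ t ht] using J₁ t ht
    · simpa only [E₃ t ht] using J₃ t ht
    · exact (integrableOn_congr_fun (fun t ht => M₁ t ht) measurableSet_Ioo).2 (I₁.1.const_mul _)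
    · exact (integrableOn_congr_fun (fun t ht => M₃ t ht) measurableSet_Ioo).2 (I₃.1.const_mul _)
    · rw [L₁, L₃, ← mul_neg]
      congr 1
      linarith

/-! ### The defect -/

theorem defect_add_period (T : ℝ → E → Sym3) (b : E) (f : ℝ → ℝ) {t : ℝ} (ht : t ∈ Ico 0 Te)
    (s : ℝ) : c.defect T b f (t, s + c.period) = c.defect T b f (t, s) := by
  simp only [defect, traction, Y]
  rw [c.ds_add_period ht, c.dt_add_period ht, c.y_add_period ht]

theorem continuousWithinAt_defect {T : ℝ → E → Sym3}
    (hT : ContinuousOn (fun p : ℝ × E => T p.1 p.2) (Icc 0 Te ×ˢ closure Ω)) (b : E) {f : ℝ → ℝ}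
    (hf : Continuous f) {q : ℝ × ℝ} (hq : q ∈ strip Te) (hbq : cross b (c.ds q) ≠ 0) :
    ContinuousWithinAt (c.defect T b f) (strip Te) q := by
  have h1 := c.continuousOn_dt q hq
  have h2 := c.continuousOn_ds q hq
  have h3 := c.continuousOn_traction hT b q hq
  have h4 : ContinuousWithinAt (fun q => fluxFn b f (c.traction T b q) (c.ds q)) (strip Te) q :=
    ContinuousAt.comp_continuousWithinAt (g := fun p : E × E => fluxFn b f p.1 p.2)
      (f := fun q => (c.traction T b q, c.ds q)) (continuousAt_fluxFn b hf hbq) (h3.prodMk h2)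
  have h5 : ContinuousWithinAt (fun q => cross (c.dt q) (c.ds q)) (strip Te) q :=
    ContinuousAt.comp_continuousWithinAt (g := fun p : E × E => cross p.1 p.2)
      (f := fun q => (c.dt q, c.ds q)) continuous_cross.continuousAt (h1.prodMk h2)
  exact h5.sub (h2.norm.smul h4)

theorem eventually_cross_ne_zero (b : E) {q : ℝ × ℝ} (hq : q ∈ strip Te)
    (hbq : cross b (c.ds q) ≠ 0) : ∀ᶠ p in 𝓝[strip Te] q, cross b (c.ds p) ≠ 0 := by
  have h : ContinuousWithinAt (fun q => cross b (c.ds q)) (strip Te) q :=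
    ContinuousAt.comp_continuousWithinAt (g := fun x : E => cross b x)
      (continuous_cross.comp (continuous_const.prodMk continuous_id)).continuousAt
      (c.continuousOn_ds q hq)
  exact h.eventually (isOpen_ne.mem_nhds hbq)

/-- Both terms are multiples of cross products with `∂_s y`. Normality matters because the field in
`eq_zero_of_integral_rot_line` detects only the normal part. -/
theorem inner_ds_defect (T : ℝ → E → Sym3) (b : E) (f : ℝ → ℝ) (q : ℝ × ℝ) :
    inner ℝ (c.ds q) (c.defect T b f q) = 0 := by
  simp only [defect, fluxFn, slipDir]
  rw [inner_sub_right, inner_cross_self_right, real_inner_smul_right, real_inner_smul_right,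
    real_inner_smul_right, inner_cross_self_right]
  simp

theorem cross_tangent_ne_zero_iff (b : E) {t : ℝ} (ht : t ∈ Ico 0 Te) (s : ℝ) :
    cross b (c.tangent t (c.y t s)) ≠ 0 ↔ cross b (c.ds (t, s)) ≠ 0 := by
  rw [c.tangent_eq ht, cross_smul_right]
  simp [c.ds_ne_zero ht s]

/-- The law of motion holds at a point of the curve if and only if the defect vanishes there. -/
theorem hasNormalVelocity_law_iff (hΩ : IsOpen Ω) (T : ℝ → E → Sym3) (b : E) (f : ℝ → ℝ) {t : ℝ}
    (ht : t ∈ Ico 0 Te) (s : ℝ) :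
    c.HasNormalVelocity t (c.y t s)
      (f (inner ℝ (c.bPerp b t (c.y t s)) (c.force T b t (c.y t s))) • c.bPerp b t (c.y t s)) ↔
    c.defect T b f (t, s) = 0 := by
  rw [c.hasNormalVelocity_iff hΩ ht]
  have hτ := c.norm_tangent ht s
  have hn := c.norm_ds_pos ht s
  have hlaw := cross_force_law b f (c.traction T b (t, s)) hτ
  have hproj := cross_projPerp hτ (c.dt (t, s))
  have hdef : c.defect T b f (t, s) = ‖c.ds (t, s)‖ •
      (cross (c.dt (t, s)) (c.tangent t (c.y t s)) -
        fluxFn b f (c.traction T b (t, s)) (c.tangent t (c.y t s))) := by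
    rw [defect, smul_sub, ← cross_smul_right, c.smul_tangent ht]
    conv_lhs => rw [← c.smul_tangent ht s, fluxFn_smul _ _ _ _ hn]
    rw [c.smul_tangent ht s]
  rw [hdef, smul_eq_zero_iff_right hn.ne', sub_eq_zero, ← hlaw, ← hproj]
  constructor
  · intro h
    rw [← h]
    rfl
  · intro h
    refine (cross_left_injective hτ (inner_projPerp _ _) ?_ h).symm
    rw [real_inner_smul_right, real_inner_smul_right, inner_projPerp, mul_zero, mul_zero]

/-! ### Blow-up at a point of the curve -/

/-- Concentration at scale `ε` in space but `ε²` in time: during such a time the curve moves by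
`O(ε²)`, which is negligible at scale `ε`. -/
theorem isTestField_scaled {t₀ ε : ℝ} {x₀ : E} (η : ContDiffBump (0 : ℝ)) (hη : η.rOut = 2)
    {V : E → E} (hV : ContDiff ℝ ∞ V) (hVs : tsupport V ⊆ Metric.closedBall 0 2) (hε : 0 < ε)
    (ht : Icc (t₀ - 2 * ε ^ 2) (t₀ + 2 * ε ^ 2) ⊆ Ioo 0 Te)
    (hx : Metric.closedBall x₀ (2 * ε) ⊆ Ω) :
    IsTestField Ω Te fun t x => η ((ε ^ 2)⁻¹ * (t - t₀)) • V (ε⁻¹ • (x - x₀)) := by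
  have hzero : ∀ p : ℝ × E,
      p ∉ Icc (t₀ - 2 * ε ^ 2) (t₀ + 2 * ε ^ 2) ×ˢ Metric.closedBall x₀ (2 * ε) →
      η ((ε ^ 2)⁻¹ * (p.1 - t₀)) • V (ε⁻¹ • (p.2 - x₀)) = 0 := by
    intro p hp
    by_contra hne
    refine hp ⟨?_, ?_⟩
    · have h1 : η ((ε ^ 2)⁻¹ * (p.1 - t₀)) ≠ 0 := fun h => hne (by rw [h, zero_smul])
      have h2 : (ε ^ 2)⁻¹ * (p.1 - t₀) ∈ Metric.ball (0 : ℝ) η.rOut := by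
        rw [← η.support_eq]; exact h1
      rw [hη, Metric.mem_ball, dist_zero_right, Real.norm_eq_abs, abs_mul,
        abs_of_pos (by positivity), inv_mul_lt_iff₀ (by positivity)] at h2
      have h3 := abs_lt.1 h2
      constructor <;> nlinarith
    · have h1 : V (ε⁻¹ • (p.2 - x₀)) ≠ 0 := fun h => hne (by rw [h, smul_zero])
      have h2 := hVs (subset_tsupport _ h1)
      rw [Metric.mem_closedBall, dist_zero_right, norm_smul, Real.norm_eq_abs,
        abs_of_pos (by positivity), inv_mul_le_iff₀ hε] at h2
      rw [Metric.mem_closedBall, dist_eq_norm, mul_comm]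
      exact h2
  refine ⟨?_, ?_, ?_⟩
  · have h1 : ContDiff ℝ ∞ fun p : ℝ × E => η ((ε ^ 2)⁻¹ * (p.1 - t₀)) :=
      η.contDiff.comp (contDiff_const.mul (contDiff_fst.sub contDiff_const))
    have h2 : ContDiff ℝ ∞ fun p : ℝ × E => V (ε⁻¹ • (p.2 - x₀)) :=
      hV.comp ((contDiff_snd.sub contDiff_const).const_smul ε⁻¹)
    exact h1.smul h2
  · exact HasCompactSupport.intro (isCompact_Icc.prod (isCompact_closedBall _ _)) hzero
  · refine (closure_minimal (fun p hp => ?_) (isClosed_Icc.prod Metric.isClosed_closedBall)).trans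
      (prod_mono ht hx)
    by_contra h
    exact hp (hzero p h)

theorem rot_scaled {V : E → E} (hV : ContDiff ℝ ∞ V) (k ε : ℝ) (x₀ x : E) :
    rot (fun x => k • V (ε⁻¹ • (x - x₀))) x = ε⁻¹ • k • rot V (ε⁻¹ • (x - x₀)) := by
  have h1 : HasFDerivAt (fun x : E => ε⁻¹ • (x - x₀)) (ε⁻¹ • ContinuousLinearMap.id ℝ E) x :=
    ((hasFDerivAt_id x).sub_const x₀).const_smul ε⁻¹
  have h2 := ((hV.differentiable (by simp) (ε⁻¹ • (x - x₀))).hasFDerivAt.comp x h1).const_smul k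
  rw [rot_eq, rot_eq, ← map_smul, ← map_smul]
  congr 1
  refine h2.fderiv.trans ?_
  ext u
  simp [mul_left_comm]

theorem rot_eq_zero_of_two_lt {V : E → E} (hVs : tsupport V ⊆ Metric.closedBall 0 2) {z : E}
    (hz : 2 < ‖z‖) : rot V z = 0 := by
  have h : fderiv ℝ V z = 0 := image_eq_zero_of_notMem_tsupport fun h => by
    have := hVs (tsupport_fderiv_subset ℝ h)
    rw [Metric.mem_closedBall, dist_zero_right] at this
    linarith
  rw [rot_eq, h, map_zero]

theorem continuous_rot {V : E → E} (hV : ContDiff ℝ ∞ V) : Continuous (rot V) :=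
  rotL.continuous.comp (hV.continuous_fderiv (by simp))

/-- The integrand of the weak equation for a test field concentrated at a point of the curve. -/
def scaledIntegrand (W : ℝ × ℝ → E) (η : ContDiffBump (0 : ℝ)) (V : E → E) (t₀ s₀ ε t s : ℝ) : ℝ :=
  η ((ε ^ 2)⁻¹ * (t - t₀)) * inner ℝ (rot V (ε⁻¹ • (c.y t s - c.y t₀ s₀))) (W (t, s))

theorem eventually_mul_lt (M : ℝ) {κ : ℝ} (hκ : 0 < κ) : ∀ᶠ ε in 𝓝[>] (0 : ℝ), M * ε < κ := by
  have h : Tendsto (fun ε : ℝ => M * ε) (𝓝[>] 0) (𝓝 0) := by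
    have : Continuous fun ε : ℝ => M * ε := by fun_prop
    simpa using (this.tendsto 0).mono_left nhdsWithin_le_nhds
  exact h.eventually (gt_mem_nhds hκ)

/-- For small `ε` the integral of the scaled integrand is an integral over a small rectangle. -/
theorem exists_rectangle (hΩ : IsOpen Ω) {t₀ : ℝ} (s₀ : ℝ) (ht₀ : t₀ ∈ Ioo 0 Te) :
    ∃ L : ℝ, 0 < L ∧ ∀ (W : ℝ × ℝ → E) (η : ContDiffBump (0 : ℝ)) (V : E → E),
      (∀ t ∈ Ico 0 Te, ∀ s, W (t, s + c.period) = W (t, s)) → η.rOut = 2 → ContDiff ℝ ∞ V →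
      tsupport V ⊆ Metric.closedBall 0 2 →
      (∀ φ : ℝ → E → E, IsTestField Ω Te φ →
        ∫ t in Ioo 0 Te, ∫ s in c.dom, inner ℝ (rot (φ t) (c.y t s)) (W (t, s)) = 0) →
      ∀ᶠ ε in 𝓝[>] (0 : ℝ), ∫ t in (ε ^ 2 * -2 + t₀)..(ε ^ 2 * 2 + t₀),
        ∫ s in (ε * -L + s₀)..(ε * L + s₀), c.scaledIntegrand W η V t₀ s₀ ε t s = 0 := by
  obtain ⟨r, C, hr, hC, hloc⟩ := c.exists_param_le hΩ s₀ (Ioo_subset_Ico_self ht₀)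
  obtain ⟨rΩ, hrΩ, hball⟩ :=
    Metric.isOpen_iff.1 hΩ _ (c.mem t₀ (Ioo_subset_Ico_self ht₀) s₀)
  -- On the support `|t - t₀| ≤ 2 ε² ≤ 2 ε` and the distance to the point is at most `2 ε`, so the
  -- parameters differ by at most `4 C ε < L ε`.
  refine ⟨4 * C + 1, by linarith, fun W η V hW hη hV hVs hint => ?_⟩
  set L := 4 * C + 1
  have hper : ∀ᶠ ε in 𝓝[>] (0 : ℝ), 0 < c.period → L * ε < c.period / 2 := by
    by_cases hp : 0 < c.period
    · exact (eventually_mul_lt L (half_pos hp)).mono fun _ h _ => h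
    · exact Eventually.of_forall fun _ h => absurd h hp
  filter_upwards [self_mem_nhdsWithin, eventually_mul_lt 1 one_pos, eventually_mul_lt 2 hr,
    eventually_mul_lt 2 ht₀.1, eventually_mul_lt 2 (sub_pos.2 ht₀.2), eventually_mul_lt 2 hrΩ, hper]
    with ε hε h1 h2r h2t h2T h2Ω hLp
  replace hε : 0 < ε := hε
  rw [one_mul] at h1
  have hε2 : ε ^ 2 ≤ ε := by nlinarith
  have hε2p : 0 < ε ^ 2 := by positivity
  have hIcc : Icc (t₀ - 2 * ε ^ 2) (t₀ + 2 * ε ^ 2) ⊆ Ioo 0 Te := fun t ht =>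
    ⟨by linarith [ht.1], by linarith [ht.2]⟩
  have htest := isTestField_scaled (Te := Te) (t₀ := t₀) (x₀ := c.y t₀ s₀) η hη hV hVs hε hIcc
    ((Metric.closedBall_subset_ball h2Ω).trans hball)
  have h0 := hint _ htest
  have hη0 : ∀ t, t ∉ Ioc (ε ^ 2 * -2 + t₀) (ε ^ 2 * 2 + t₀) → η ((ε ^ 2)⁻¹ * (t - t₀)) = 0 := by
    intro t ht
    refine η.zero_of_le_dist ?_
    rw [hη, dist_zero_right, Real.norm_eq_abs, abs_mul, abs_of_pos (by positivity),
      le_inv_mul_iff₀ hε2p]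
    by_contra! h
    have := abs_lt.1 h
    exact ht ⟨by linarith [this.1], by linarith [this.2]⟩
  have hscale : ∀ t s, inner ℝ (rot (fun x => η ((ε ^ 2)⁻¹ * (t - t₀)) • V (ε⁻¹ • (x - c.y t₀ s₀)))
      (c.y t s)) (W (t, s)) = ε⁻¹ * c.scaledIntegrand W η V t₀ s₀ ε t s := by
    intro t s
    rw [rot_scaled hV, real_inner_smul_left, real_inner_smul_left, scaledIntegrand]
  simp only [hscale, integral_const_mul] at h0
  have h0' := (mul_eq_zero.1 h0).resolve_left (inv_ne_zero hε.ne')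
  have hslice : ∀ t ∈ Ioo 0 Te, ∫ s in c.dom, c.scaledIntegrand W η V t₀ s₀ ε t s =
      ∫ s in (ε * -L + s₀)..(ε * L + s₀), c.scaledIntegrand W η V t₀ s₀ ε t s := by
    intro t ht
    by_cases htI : t ∈ Ioc (ε ^ 2 * -2 + t₀) (ε ^ 2 * 2 + t₀)
    · have hperiodic : ∀ s, c.scaledIntegrand W η V t₀ s₀ ε t (s + c.period) =
          c.scaledIntegrand W η V t₀ s₀ ε t s := by
        intro s
        simp only [scaledIntegrand]
        rw [c.y_add_period (Ioo_subset_Ico_self ht), hW t (Ioo_subset_Ico_self ht)]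
      have hLε : 0 < L * ε := mul_pos (by simp only [L]; linarith) hε
      -- For a closed curve the period interval is centred at `s₀`; since `L ε` is less than half a
      -- period, no nonzero translate can enter the window.
      rw [dom_eq, setIntegral_periodDom c.period_nonneg hperiodic 0 (s₀ - c.period / 2),
        intervalIntegral.integral_of_le (by linarith)]
      refine setIntegral_eq_of_subset_of_forall_sdiff_eq_zero (measurableSet_periodDom _ _) ?_ ?_
      · intro s hs hp
        have := hLp hp
        constructor <;> linarith [hs.1, hs.2]
      · intro s hs
        by_contra hne
        refine hs.2 ?_
        have hR : ‖ε⁻¹ • (c.y t s - c.y t₀ s₀)‖ ≤ 2 := by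
          by_contra! h
          exact hne (by rw [scaledIntegrand, rot_eq_zero_of_two_lt hVs h, inner_zero_left, mul_zero])
        rw [norm_smul, Real.norm_eq_abs, abs_of_pos (inv_pos.2 hε), inv_mul_le_iff₀ hε] at hR
        have htt : |t - t₀| ≤ 2 * ε ^ 2 := abs_le.2 ⟨by linarith [htI.1], by linarith [htI.2]⟩
        obtain ⟨n, hn⟩ := hloc t (Ioo_subset_Ico_self ht) (by linarith) s (by linarith)
        have hn' : |s + n * c.period - s₀| < L * ε := by
          refine hn.trans_lt ?_
          have : C * (|t - t₀| + ‖c.y t s - c.y t₀ s₀‖) ≤ C * (4 * ε) := by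
            refine mul_le_mul_of_nonneg_left ?_ hC.le
            linarith
          simp only [L]
          linarith
        have hn0 : n * c.period = 0 := by
          rcases c.period_nonneg.eq_or_lt with hp | hp
          · rw [← hp, mul_zero]
          · have hsd := hs.1 hp
            have hlp := hLp hp
            have hb := abs_lt.1 hn'
            have h3 : (n : ℝ) < 1 := by
              by_contra! h
              nlinarith [hsd.1]
            have h4 : (-1 : ℝ) < n := by
              by_contra! h
              nlinarith [hsd.2]
            have h5 : n < 1 := by exact_mod_cast h3
            have h6 : -1 < n := by exact_mod_cast h4
            have h7 : n = 0 := by omega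
            rw [h7]; simp
        rw [hn0, add_zero] at hn'
        have := abs_lt.1 hn'
        exact ⟨by linarith [this.1], by linarith [this.2]⟩
    · simp only [scaledIntegrand, hη0 t htI, zero_mul]
      simp
  rw [← h0', intervalIntegral.integral_of_le (by linarith),
    setIntegral_congr_fun measurableSet_Ioo hslice]
  refine (setIntegral_eq_of_subset_of_forall_sdiff_eq_zero measurableSet_Ioo ?_ ?_).symm
  · intro t ht
    exact hIcc ⟨by linarith [ht.1], by linarith [ht.2]⟩
  · intro t ht
    simp only [scaledIntegrand, hη0 t ht.2, zero_mul]
    simp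

/-- The weak equation at a point of the curve, after blow-up: the tangent line carries the value of
the weight at the point. -/
theorem exists_integral_rot_line_eq_zero (hΩ : IsOpen Ω) {t₀ : ℝ} (s₀ : ℝ) (ht₀ : t₀ ∈ Ioo 0 Te)
    (W : ℝ × ℝ → E) (hWp : ∀ t ∈ Ico 0 Te, ∀ s, W (t, s + c.period) = W (t, s))
    (hWc : ∀ᶠ q in 𝓝 (t₀, s₀), ContinuousAt W q)
    (hint : ∀ φ : ℝ → E → E, IsTestField Ω Te φ →
      ∫ t in Ioo 0 Te, ∫ s in c.dom, inner ℝ (rot (φ t) (c.y t s)) (W (t, s)) = 0) :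
    ∃ L : ℝ, 0 < L ∧ ∀ V : E → E, ContDiff ℝ ∞ V → tsupport V ⊆ Metric.closedBall 0 2 →
      ∫ σ in -L..L, inner ℝ (rot V (σ • c.ds (t₀, s₀))) (W (t₀, s₀)) = 0 := by
  obtain ⟨L, hL, hrect⟩ := c.exists_rectangle hΩ s₀ ht₀
  refine ⟨L, hL, fun V hV hVs => ?_⟩
  let η : ContDiffBump (0 : ℝ) := ⟨1, 2, one_pos, one_lt_two⟩
  have hzero := hrect W η V hWp rfl hV hVs hint
  obtain ⟨B, hB⟩ : ∃ B, ∀ z, ‖rot V z‖ ≤ B := by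
    obtain ⟨B, hB⟩ := (isCompact_closedBall (0 : E) 2).exists_bound_of_continuousOn
      (continuous_rot hV).continuousOn
    refine ⟨max B 0, fun z => ?_⟩
    by_cases hz : ‖z‖ ≤ 2
    · exact (hB z (by simpa using hz)).trans (le_max_left _ _)
    · rw [rot_eq_zero_of_two_lt hVs (not_le.1 hz), norm_zero]
      exact le_max_right _ _
  have hWq : ContinuousAt W (t₀, s₀) := hWc.self_of_nhds
  set N := ‖W (t₀, s₀)‖ + 1
  have hgood : ∀ᶠ q in 𝓝 (t₀, s₀), ContinuousAt W q ∧ ‖W q‖ < N ∧ q.1 ∈ Ioo 0 Te :=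
    hWc.and ((hWq.norm.eventually (gt_mem_nhds (lt_add_one _))).and
      (continuousAt_fst.eventually (isOpen_Ioo.mem_nhds ht₀)))
  obtain ⟨ρ, hρ, hball⟩ := Metric.eventually_nhds_iff_ball.1 hgood
  set pt : ℝ → ℝ × ℝ → ℝ × ℝ := fun ε q => (ε ^ 2 * q.1 + t₀, ε * q.2 + s₀) with hpt
  set F : ℝ → ℝ × ℝ → ℝ := fun ε q => η q.1 *
    inner ℝ (rot V (ε⁻¹ • (c.Y (pt ε q) - c.y t₀ s₀))) (W (pt ε q)) with hF
  set box : Set (ℝ × ℝ) := Icc (-2) 2 ×ˢ Icc (-L) L with hbox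
  have hboxc : IsCompact box := isCompact_Icc.prod isCompact_Icc
  have hsmall : ∀ᶠ ε in 𝓝[>] (0 : ℝ), 0 < ε ∧ ∀ q ∈ box, pt ε q ∈ Metric.ball (t₀, s₀) ρ := by
    filter_upwards [self_mem_nhdsWithin, eventually_mul_lt 1 one_pos, eventually_mul_lt 2 hρ,
      eventually_mul_lt L hρ] with ε hε h1 h2 h3
    replace hε : 0 < ε := hε
    refine ⟨hε, fun q hq => ?_⟩
    have e1 : |q.1| ≤ 2 := abs_le.2 hq.1
    have e2 : |q.2| ≤ L := abs_le.2 hq.2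
    rw [Metric.mem_ball, Prod.dist_eq, Real.dist_eq, Real.dist_eq]
    simp only [hpt, add_sub_cancel_right, abs_mul, abs_of_pos hε, abs_of_pos (pow_pos hε 2)]
    rw [one_mul] at h1
    refine max_lt ?_ ?_
    · have : ε ^ 2 * |q.1| ≤ ε * 2 := by
        refine mul_le_mul (by nlinarith) e1 (abs_nonneg _) hε.le
      linarith
    · have : ε * |q.2| ≤ ε * L := mul_le_mul_of_nonneg_left e2 hε.le
      linarith
  have hpoint : ∀ q : ℝ × ℝ, Tendsto (fun ε => F ε q) (𝓝[>] 0)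
      (𝓝 (η q.1 * inner ℝ (rot V (q.2 • c.ds (t₀, s₀))) (W (t₀, s₀)))) := by
    intro q
    -- Time enters quadratically, so only `∂_s y` survives in the limit of the rescaled curve.
    have h1 : HasDerivAt (fun ε : ℝ => pt ε q) (0, q.2) 0 := by
      refine HasDerivAt.prodMk ?_ ?_
      · simpa using (((hasDerivAt_pow 2 (0 : ℝ)).mul_const q.1).add_const t₀)
      · simpa using (((hasDerivAt_id (0 : ℝ)).mul_const q.2).add_const s₀)
    have hpt0 : pt 0 q = (t₀, s₀) := by simp [hpt]
    have h2 : HasFDerivAt c.Y (fderivWithin ℝ c.Y (strip Te) (t₀, s₀)) (pt 0 q) := by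
      rw [hpt0]; exact c.hasFDerivAt (p := (t₀, s₀)) ht₀
    have h3 := (h2.comp_hasDerivAt 0 h1).tendsto_slope_zero_right
    rw [c.fderivWithin_apply (p := (t₀, s₀)) (Ioo_subset_Ico_self ht₀)] at h3
    simp only [zero_smul, zero_add, Function.comp_apply, hpt0] at h3
    have h4 : Tendsto (fun ε => W (pt ε q)) (𝓝[>] 0) (𝓝 (W (t₀, s₀))) := by
      have : Tendsto (fun ε => pt ε q) (𝓝[>] 0) (𝓝 (t₀, s₀)) := by
        have := h1.continuousAt.tendsto
        rw [hpt0] at this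
        exact this.mono_left nhdsWithin_le_nhds
      exact hWq.tendsto.comp this
    exact (((continuous_rot hV).tendsto _ |>.comp h3).inner h4).const_mul _
  have hFc : ∀ ε, (∀ q ∈ box, pt ε q ∈ Metric.ball (t₀, s₀) ρ) → ContinuousOn (F ε) box := by
    intro ε hε q hq
    have hg := hball _ (hε q hq)
    have cpt : Continuous (pt ε) := by simp only [hpt]; fun_prop
    have c1 : ContinuousAt c.Y (pt ε q) := (c.hasFDerivAt hg.2.2).continuousAt
    have c2 : ContinuousAt (fun q => c.Y (pt ε q)) q :=
      ContinuousAt.comp (g := c.Y) c1 cpt.continuousAt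
    have c3 : ContinuousAt (fun q => W (pt ε q)) q :=
      ContinuousAt.comp (g := W) hg.1 cpt.continuousAt
    have c4 : ContinuousAt (fun q : ℝ × ℝ => rot V (ε⁻¹ • (c.Y (pt ε q) - c.y t₀ s₀))) q :=
      ContinuousAt.comp (g := rot V) (continuous_rot hV).continuousAt
        ((c2.sub continuousAt_const).const_smul ε⁻¹)
    exact ((η.continuous.comp continuous_fst).continuousAt.mul (c4.inner c3)).continuousWithinAt
  have hlim : Tendsto (fun ε => ∫ q in box, F ε q) (𝓝[>] 0)
      (𝓝 (∫ q in box, η q.1 * inner ℝ (rot V (q.2 • c.ds (t₀, s₀))) (W (t₀, s₀)))) := by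
    refine tendsto_integral_filter_of_dominated_convergence (fun _ => B * N) ?_ ?_ ?_ ?_
    · filter_upwards [hsmall] with ε hε
      exact (hFc ε hε.2).aestronglyMeasurable hboxc.measurableSet
    · filter_upwards [hsmall] with ε hε
      filter_upwards [ae_restrict_mem hboxc.measurableSet] with q hq
      have hg := hball _ (hε.2 q hq)
      have hB0 : 0 ≤ B := (norm_nonneg _).trans (hB 0)
      rw [hF, norm_mul, Real.norm_of_nonneg η.nonneg]
      calc _ ≤ 1 * (‖rot V (ε⁻¹ • (c.Y (pt ε q) - c.y t₀ s₀))‖ * ‖W (pt ε q)‖) :=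
            mul_le_mul η.le_one (norm_inner_le_norm _ _) (norm_nonneg _) zero_le_one
        _ ≤ B * N := by
            rw [one_mul]
            exact mul_le_mul (hB _) hg.2.1.le (norm_nonneg _) hB0
    · exact integrableOn_const hboxc.measure_ne_top
    · exact Eventually.of_forall hpoint
  have hF0 : ∀ᶠ ε in 𝓝[>] (0 : ℝ), ∫ q in box, F ε q = 0 := by
    filter_upwards [hsmall, hzero] with ε hε hz
    have hε0 := hε.1
    rw [Measure.volume_eq_prod, setIntegral_prod _ ((hFc ε hε.2).integrableOn_compact hboxc),
      integral_Icc_eq_integral_Ioc, ← intervalIntegral.integral_of_le (by norm_num)]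
    simp only [integral_Icc_eq_integral_Ioc]
    simp only [← intervalIntegral.integral_of_le (neg_le_self hL.le)]
    have hs : ∀ t, ∫ s in (ε * -L + s₀)..(ε * L + s₀), c.scaledIntegrand W η V t₀ s₀ ε t s =
        ε * ∫ σ in -L..L, c.scaledIntegrand W η V t₀ s₀ ε t (ε * σ + s₀) := fun t =>
      (intervalIntegral.mul_integral_comp_mul_add
        (f := fun s => c.scaledIntegrand W η V t₀ s₀ ε t s) ε s₀).symm
    simp only [hs] at hz
    rw [intervalIntegral.integral_const_mul, ← intervalIntegral.mul_integral_comp_mul_add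
      (f := fun t => ∫ σ in -L..L, c.scaledIntegrand W η V t₀ s₀ ε t (ε * σ + s₀))] at hz
    have hz' := (mul_eq_zero.1 ((mul_eq_zero.1 hz).resolve_left hε0.ne')).resolve_left
      (pow_pos hε0 2).ne'
    rw [← hz']
    refine intervalIntegral.integral_congr fun θ _ => ?_
    refine intervalIntegral.integral_congr fun σ _ => ?_
    simp only [hF, hpt, scaledIntegrand, Y, add_sub_cancel_right]
    rw [inv_mul_cancel_left₀ (pow_pos hε0 2).ne']
  have hfin : ∫ q in box, η q.1 * inner ℝ (rot V (q.2 • c.ds (t₀, s₀))) (W (t₀, s₀)) = 0 :=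
    tendsto_nhds_unique (hlim.congr' hF0) tendsto_const_nhds
  rw [Measure.volume_eq_prod, hbox, setIntegral_prod_mul (f := fun θ => η θ)
    (g := fun σ => inner ℝ (rot V (σ • c.ds (t₀, s₀))) (W (t₀, s₀))),
    integral_Icc_eq_integral_Ioc, integral_Icc_eq_integral_Ioc,
    ← intervalIntegral.integral_of_le (by norm_num),
    ← intervalIntegral.integral_of_le (neg_le_self hL.le)] at hfin
  -- The time profile has positive integral and can be divided out.
  refine (mul_eq_zero.1 hfin).resolve_left (ne_of_gt ?_)
  refine intervalIntegral.intervalIntegral_pos_of_pos_on (η.continuous.intervalIntegrable _ _)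
    (fun θ hθ => η.pos_of_mem_ball ?_) (by norm_num)
  rw [Metric.mem_ball, dist_zero_right, Real.norm_eq_abs]
  exact abs_lt.2 hθ

/-- A normal field on the tangent line whose product with all rotations integrates to zero
vanishes. -/
theorem eq_zero_of_integral_rot_line {d w : E} (hd : d ≠ 0) (hdw : inner ℝ d w = 0) {L : ℝ}
    (hL : 0 < L) (h : ∀ V : E → E, ContDiff ℝ ∞ V → tsupport V ⊆ Metric.closedBall 0 2 →
      ∫ σ in -L..L, inner ℝ (rot V (σ • d)) w = 0) : w = 0 := by
  by_contra hw
  let ψ : ContDiffBump (0 : E) := ⟨1, 2, one_pos, one_lt_two⟩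
  -- The factor `m · z` of the field vanishes on the line since `m ⟂ d`. So the gradient of the
  -- cutoff drops out there, and `rot V = ψ m × d = ψ |d|² w` because `w ⟂ d`.
  set m := cross d w with hm
  set V : E → E := fun z => (ψ z * inner ℝ m z) • d with hVdef
  have hV : ContDiff ℝ ∞ V :=
    (ψ.contDiff.mul (contDiff_const.inner ℝ contDiff_id)).smul contDiff_const
  have hVs : tsupport V ⊆ Metric.closedBall 0 2 := by
    refine closure_minimal (fun z hz => ?_) Metric.isClosed_closedBall
    have h1 : z ∈ Function.support ψ := fun h0 => hz (by simp only [hVdef, h0, zero_mul, zero_smul])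
    rw [ψ.support_eq] at h1
    exact Metric.ball_subset_closedBall h1
  have hrot : ∀ σ : ℝ, inner ℝ (rot V (σ • d)) w = ψ (σ • d) * (‖d‖ ^ 2 * ‖w‖ ^ 2) := by
    intro σ
    have hmz : inner ℝ m (σ • d) = 0 := by
      rw [real_inner_smul_right, real_inner_comm, hm, inner_cross_self_left, mul_zero]
    have h1 : HasFDerivAt (fun z => ψ z * inner ℝ m z) (ψ (σ • d) • innerSL ℝ m) (σ • d) := by
      have h2 := ((ψ.contDiff (n := 1)).differentiable one_ne_zero (σ • d)).hasFDerivAt.mul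
        (innerSL ℝ m).hasFDerivAt
      refine h2.congr_fderiv ?_
      simp only [innerSL_apply_apply, hmz, zero_smul, add_zero]
    have h3 : fderiv ℝ V (σ • d) = (ψ (σ • d) • innerSL ℝ m).smulRight d :=
      (h1.smul_const d).fderiv
    rw [rot_eq, h3, rotL_smulRight _ (ψ (σ • d) • m) d fun u => by
        simp [real_inner_smul_left], cross_smul_left, hm, cross_cross_self, hdw, zero_smul, sub_zero,
      real_inner_smul_left, real_inner_smul_left, real_inner_self_eq_norm_sq,
      real_inner_self_eq_norm_sq]
  have h0 := h V hV hVs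
  simp only [hrot] at h0
  have hpos : 0 < ∫ σ in -L..L, ψ (σ • d) * (‖d‖ ^ 2 * ‖w‖ ^ 2) := by
    have hdn := norm_pos_iff.2 hd
    have hwn := norm_pos_iff.2 hw
    refine intervalIntegral.integral_pos (by linarith) ?_ ?_ ⟨0, ⟨by linarith, hL.le⟩, ?_⟩
    · exact ((ψ.continuous.comp (continuous_id.smul continuous_const)).mul
        continuous_const).continuousOn
    · intro σ _
      exact mul_nonneg ψ.nonneg (by positivity)
    · have : 0 < ψ ((0 : ℝ) • d) := ψ.pos_of_mem_ball (by simp [ψ])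
      positivity
  exact hpos.ne' h0

/-! ### The weak equation and the pointwise law of motion -/

theorem defect_eq_zero_of_solves (hΩ : IsOpen Ω) {T : ℝ → E → Sym3}
    (hT : ContinuousOn (fun p : ℝ × E => T p.1 p.2) (Icc 0 Te ×ˢ closure Ω)) (b : E) {f : ℝ → ℝ}
    (hf : Continuous f)
    (hint : ∀ φ : ℝ → E → E, IsTestField Ω Te φ →
      ∫ t in Ioo 0 Te, ∫ s in c.dom, inner ℝ (rot (φ t) (c.y t s)) (c.defect T b f (t, s)) = 0)
    {t : ℝ} (ht : t ∈ Ico 0 Te) (s : ℝ) (hbs : cross b (c.ds (t, s)) ≠ 0) :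
    c.defect T b f (t, s) = 0 := by
  have interior : ∀ t ∈ Ioo 0 Te, cross b (c.ds (t, s)) ≠ 0 → c.defect T b f (t, s) = 0 := by
    intro t ht hbs
    have hnhds : ∀ q : ℝ × ℝ, q.1 ∈ Ioo 0 Te → 𝓝[strip Te] q = 𝓝 q := fun q hq =>
      nhdsWithin_eq_nhds.2 (prod_mem_nhds (Ico_mem_nhds hq.1 hq.2) univ_mem)
    have hmem := mem_strip.2 (Ioo_subset_Ico_self ht : (t, s).1 ∈ Ico 0 Te)
    have hev := c.eventually_cross_ne_zero b hmem hbs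
    rw [hnhds _ ht] at hev
    have hWc : ∀ᶠ q in 𝓝 (t, s), ContinuousAt (c.defect T b f) q := by
      filter_upwards [hev, continuousAt_fst.eventually (isOpen_Ioo.mem_nhds ht)] with q hq hqt
      have := c.continuousWithinAt_defect hT b hf (mem_strip.2 (Ioo_subset_Ico_self hqt)) hq
      rwa [ContinuousWithinAt, hnhds q hqt] at this
    obtain ⟨L, hL, hline⟩ := c.exists_integral_rot_line_eq_zero hΩ s ht (c.defect T b f)
      (fun t ht s => c.defect_add_period T b f ht s) hWc hint
    exact eq_zero_of_integral_rot_line (c.ds_ne_zero (Ioo_subset_Ico_self ht) s)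
      (c.inner_ds_defect T b f _) hL hline
  -- At `t = 0` the defect is the limit of its values at later times with the same `s`, where `b ×
  -- ∂_s y ≠ 0` persists and the interior case applies.
  rcases ht.1.eq_or_lt with h0 | h0
  · have hmem : (t, s) ∈ strip Te := mem_strip.2 ht
    have hmap : Tendsto (fun r : ℝ => (r, s)) (𝓝[>] t) (𝓝[strip Te] (t, s)) := by
      refine tendsto_nhdsWithin_iff.2 ⟨?_, ?_⟩
      · have : Continuous fun r : ℝ => (r, s) := by fun_prop
        exact (this.tendsto t).mono_left nhdsWithin_le_nhds
      · filter_upwards [Ioo_mem_nhdsGT ht.2] with r hr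
        exact mem_strip.2 ⟨ht.1.trans hr.1.le, hr.2⟩
    refine tendsto_nhds_unique ((c.continuousWithinAt_defect hT b hf hmem hbs).tendsto.comp hmap)
      (tendsto_const_nhds.congr' ?_)
    filter_upwards [hmap.eventually (c.eventually_cross_ne_zero b hmem hbs), Ioo_mem_nhdsGT ht.2]
      with r hr hrI
    exact (interior r ⟨ht.1.trans_lt hrI.1, hrI.2⟩ hr).symm
  · exact interior t ⟨h0, ht.2⟩ hbs

/-- A moving dislocation curve solves the evolution equation if and only if its normal velocity
obeys the law of motion. -/
theorem solvesEvolution_iff_hasNormalVelocity (hΩ : IsOpen Ω) (hTe : 0 < Te) {b : E} (hb : b ≠ 0)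
    {f : ℝ → ℝ} (hf : Continuous f) {T : ℝ → E → Sym3}
    (hT : ContinuousOn (fun p : ℝ × E => T p.1 p.2) (Icc 0 Te ×ˢ closure Ω))
    (hne : ∀ᵐ t, t ∈ Ioo 0 Te → ∀ᵐ x ∂(c.rho b t).mass, cross b (c.tangent t x) ≠ 0) :
    SolvesEvolution Ω Te b f T (c.rho b) ↔
      ∀ t ∈ Ico 0 Te, ∀ x ∈ c.carrier t, cross b (c.tangent t x) ≠ 0 →
        c.HasNormalVelocity t x
          (f (inner ℝ (c.bPerp b t x) (c.force T b t x)) • c.bPerp b t x) := by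
  rw [c.solvesEvolution_iff hb hf hTe hT]
  constructor
  · rintro hint t ht _ ⟨s, rfl⟩ hcr
    exact (c.hasNormalVelocity_law_iff hΩ T b f ht s).2 (c.defect_eq_zero_of_solves hΩ hT b hf hint
      ht s ((c.cross_tangent_ne_zero_iff b ht s).1 hcr))
  -- The law makes the defect vanish only where `b × τ ≠ 0`; by `hne` these are almost all points at
  -- almost all times, enough for the integral.
  · intro hlaw φ _
    refine integral_eq_zero_of_ae ((ae_restrict_iff' measurableSet_Ioo).2 ?_)
    filter_upwards [hne] with t h ht
    have htI := Ioo_subset_Ico_self ht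
    refine integral_eq_zero_of_ae ?_
    filter_upwards [c.ae_param_of_ae_mass hb htI (h ht)] with s hs
    rw [(c.hasNormalVelocity_law_iff hΩ T b f htI s).1 (hlaw t htI _ ⟨s, rfl⟩ hs), inner_zero_right]
    rfl

end MovingCurve

end Dislocation

end

theorem theorem3p5 (b : E) (hb : b ≠ 0) (f : ℝ → ℝ) (hf : Continuous f)
    (hf_sign : ∀ r : ℝ, 0 ≤ r * f r) :
    -- (i)
    (∀ τ ξ : E, ‖τ‖ = 1 → 0 ≤ inner ℝ ξ (alphaTilde b f τ ξ)) ∧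
    -- (ii)
    (∀ (Ω : Set E) (Te : ℝ) (T : ℝ → E → Sym3) (c : MovingCurve Ω Te),
      IsOpen Ω → 0 < Te →
      ContinuousOn (fun p : ℝ × E => T p.1 p.2) (Icc 0 Te ×ˢ closure Ω) →
      (∀ t ∈ Ico 0 Te, IsDislocationMeasure Ω (c.rho b t)) →
      (∀ᵐ t, t ∈ Ioo 0 Te → ∀ᵐ x ∂(c.rho b t).mass, cross b (c.tangent t x) ≠ 0) →
      (SolvesEvolution Ω Te b f T (c.rho b) ↔
        ∀ t ∈ Ico 0 Te, ∀ x ∈ c.carrier t, cross b (c.tangent t x) ≠ 0 →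
          c.HasNormalVelocity t x
            (f (inner ℝ (c.bPerp b t x) (c.force T b t x)) • c.bPerp b t x))) ∧
    -- (iii)
    (∀ (Ω : Set E) (Te : ℝ) (D : Sym3 →ₗ[ℝ] Sym3) (u : ℝ → E → E) (T : ℝ → E → Sym3)
      (h τ : ℝ → E → E),
      IsOpen Ω → 0 < Te → IsElasticityTensor D → IsFieldSolution Ω Te b f D u T h τ →
      (∀ x ∈ Ω, inner ℝ b (h 0 x) = 0) →
      ∀ t ∈ Ico 0 Te, ∀ x ∈ Ω, Matrix.trace (tensor (‖b‖⁻¹ • b) (h t x)) = 0) :=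
  ⟨fun τ ξ _ => inner_alphaTilde_nonneg b hf_sign τ ξ,
    fun _ _ _ c hΩ hTe hT _ hne =>
      c.solvesEvolution_iff_hasNormalVelocity hΩ hTe hb hf hT hne,
    fun _ _ _ _ _ _ _ _ hTe _ H h0 _ ht _ hx => H.trace_eq_zero hTe h0 ht hx⟩
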